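/- **Setting.** Let $K\ge 1$, let $\mathcal X\subseteq\mathbb R^d$ be closed and convex, let $\mathcal Y$ be a measurable space, and let $l:\mathcal X\times\mathcal Y\to\mathbb R$ be a measurable loss such that, for every $y\in\mathcal Y$, $x\mapsto l(x,y)$ is $L$-Lipschitz on $\mathcal X$ ($L\ge 0$) and $\rho$-strongly convex on $\mathcal X$ ($\rho>0$), meaning that $x\mapsto l(x,y)-\frac{\rho^2}{2}\|x\|^2$ is convex. Put $B:=8L^2/\rho^2$ and assume that $|l|\le B$ on $\mathcal X\times\mathcal Y$. Let $(Y_t,F_{1,t},\dots,F_{K,t})_{t\ge 1}$ be i.i.d. rounds, with $Y_t\in\mathcal Y$ and $F_{i,t}\in\mathcal X$ almost surely. For a prediction rule $g$, i.e. a function of the experts' advice $(F_1,\dots,F_K)$, let $R(g):=\mathbb E[l(g(F_1,\dots,F_K),Y)]$ be its risk on a fresh round $(Y,F_1,\dots,F_K)$ of the same law, and let $R^*:=\min_{1\le i\le K}R(F_i)$. **Algorithm (two queries per round), with inputs $\delta\in(0,1)$, $L$, $\rho$.** For experts $i,j$ let $T_i(t)$ be the number of rounds $s\le t$ in which $i$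 was queried and $T_{ij}(t)$ the number of rounds $s\le t$ in which both $i$ and $j$ were queried (so $T_{ii}=T_i$). Let $\hat R_i(t)$ be the mean of $l(F_{i,s},Y_s)$ over the former rounds, and let $\hat R_{ij}(i,t)$, $\hat R_{ij}(j,t)$ and $\hat d_{ij}(t)^2$ be the means of $l(F_{i,s},Y_s)$, $l(F_{j,s},Y_s)$ and $\|F_{i,s}-F_{j,s}\|^2$ over the latter rounds. With $\delta_t:=\delta/(t(t+1))$ and $\alpha_{ij}(t):=\sqrt{\log(4K\delta_t^{-1})/T_{ij}(t)}$ ($=\infty$ if $T_{ij}(t)=0$) let $$\Delta'_{ij}(t):=\hat R_{ij}(j,t)-\hat R_{ij}(i,t)-6\max\{L\,\alpha_{ij}(t)\,\hat d_{ij}(t),\;B\,\alpha_{ij}(t)^2\},$$ where $\Delta'_{ij}(t)=-\infty$ if $T_{ij}(t)=0$. Start with $S=\{1,\dots,K\}$. In each round $t=1,2,\dots$: query a pair $(i,j)\in S\times S$ that minimizes $T_{uv}(t-1)$ over $(u,v)\in S\times S$, ties being broken by any rule that uses only the past and possibly independent randomization; then remove from $S$ every $v$ such that $\Delta'_{uv}(t)>0$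 for some $u\in\{1,\dots,K\}$. When interrupted after round $T$: choose any $\hat k\in S$; choose $\hat l\in S$ maximizing $\hat d_{\hat k j}(T)$ over $j\in S$, with $\hat l\ne\hat k$ unless $S=\{\hat k\}$; choose $\hat q\in S$ minimizing $\hat R_j(T)$ over $j\in S$. Return $\hat g=\frac12(F_{\hat k}+F_{\hat l})$ if $T_{\hat k\hat l}(T)>\sqrt{\log(KT\delta^{-1})\,T_{\hat q}(T)}$, and $\hat g=F_{\hat q}$ otherwise. (If $S$ becomes empty, the further queries and the experts $\hat k,\hat l,\hat q$ are arbitrary.) **Statement.** There is an absolute constant $c>0$ such that, in this setting, for every $\delta\in(0,1)$ and every $T\ge 2K^2$, the output $\hat g$ of the algorithm after round $T$ satisfies, with probability at least $1-3\delta$, $$R(\hat g)\le R^*+c\,B\,\min\left\{\frac{K^2\log(TK\delta^{-1})}{T},\ \sqrt{\frac{K\log(TK\delta^{-1})}{T}}\right\}.$$ -/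

import Mathlib

open MeasureTheory ProbabilityTheory

namespace ExpertAdvice

/-- One training round: the target `Y` together with the advice `F_1, ..., F_K` of the experts,
which are vectors of `ℝ^d`. -/
abbrev Round (𝓨 : Type*) (K d : ℕ) : Type _ := 𝓨 × (Fin K → EuclideanSpace ℝ (Fin d))

/-- The loss is `L`-Lipschitz and `ρ`-strongly convex in its first argument, on the set `X`.
The convention is that `f` is `ρ`-strongly convex when `x ↦ f x - ρ ^ 2 / 2 * ‖x‖ ^ 2` is convex,
which is strong convexity with modulus `ρ ^ 2`. -/
structure LipschitzStronglyConvex {𝓨 : Type*} {d : ℕ} (X : Set (EuclideanSpace ℝ (Fin d)))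
    (loss : EuclideanSpace ℝ (Fin d) → 𝓨 → ℝ) (L ρ : ℝ) : Prop where
  lipschitz : ∀ y, ∀ x ∈ X, ∀ x' ∈ X, |loss x y - loss x' y| ≤ L * ‖x - x'‖
  strongConvex : ∀ y, StrongConvexOn X (ρ ^ 2) (fun x => loss x y)

/-- `B = 8 L² / ρ²`. -/
noncomputable def lossBound (L ρ : ℝ) : ℝ := 8 * L ^ 2 / ρ ^ 2

/-- The generalization risk, on a fresh round with law `P`, of the forecast `g (F_1, ..., F_K)`. -/
noncomputable def risk {𝓨 : Type*} [MeasurableSpace 𝓨] {K d : ℕ}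
    (loss : EuclideanSpace ℝ (Fin d) → 𝓨 → ℝ) (P : Measure (Round 𝓨 K d))
    (g : (Fin K → EuclideanSpace ℝ (Fin d)) → EuclideanSpace ℝ (Fin d)) : ℝ :=
  ∫ z, loss (g z.2) z.1 ∂P

/-- `R* = min_i R(F_i)`, the risk of the best expert. -/
noncomputable def bestRisk {𝓨 : Type*} [MeasurableSpace 𝓨] {K d : ℕ}
    (loss : EuclideanSpace ℝ (Fin d) → 𝓨 → ℝ) (P : Measure (Round 𝓨 K d)) : ℝ :=
  ⨅ i : Fin K, risk loss P (fun f => f i)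

/-! ### Statistics of one sample path

`pair s` is the pair of experts queried in round `s = 1, 2, ...`, and `z s` is the data of
round `s`. Index `0` is never used. -/

/-- The rounds among `1, ..., t` in which experts `i` and `j` are both queried. For `i = j` these
are the rounds in which expert `i` is queried. -/
def jointRounds {K : ℕ} (pair : ℕ → Fin K × Fin K) (i j : Fin K) (t : ℕ) : Finset ℕ :=
  (Finset.Icc 1 t).filter fun s =>
    (i = (pair s).1 ∨ i = (pair s).2) ∧ (j = (pair s).1 ∨ j = (pair s).2)

/-- `T_ij(t)`. -/
def jointCount {K : ℕ} (pair : ℕ → Fin K × Fin K) (i j : Fin K) (t : ℕ) : ℕ :=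
  (jointRounds pair i j t).card

/-- The rounds among `1, ..., t` in which expert `i` is queried. -/
def queryRounds {K : ℕ} (pair : ℕ → Fin K × Fin K) (i : Fin K) (t : ℕ) : Finset ℕ :=
  (Finset.Icc 1 t).filter fun s => i = (pair s).1 ∨ i = (pair s).2

/-- `T_i(t)`. -/
def queryCount {K : ℕ} (pair : ℕ → Fin K × Fin K) (i : Fin K) (t : ℕ) : ℕ :=
  (queryRounds pair i t).card

/-- The empirical loss of expert `k` over the rounds up to `t` where `i` and `j` are jointly
queried (used for `k = i` and `k = j`). -/
noncomputable def jointEmpLoss {𝓨 : Type*} {K d : ℕ} (loss : EuclideanSpace ℝ (Fin d) → 𝓨 → ℝ)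
    (pair : ℕ → Fin K × Fin K) (z : ℕ → Round 𝓨 K d) (i j k : Fin K) (t : ℕ) : ℝ :=
  (∑ s ∈ jointRounds pair i j t, loss ((z s).2 k) (z s).1) / (jointCount pair i j t : ℝ)

/-- The empirical loss of expert `i` over all the rounds up to `t` where it is queried. -/
noncomputable def empLoss {𝓨 : Type*} {K d : ℕ} (loss : EuclideanSpace ℝ (Fin d) → 𝓨 → ℝ)
    (pair : ℕ → Fin K × Fin K) (z : ℕ → Round 𝓨 K d) (i : Fin K) (t : ℕ) : ℝ :=
  (∑ s ∈ queryRounds pair i t, loss ((z s).2 i) (z s).1) / (queryCount pair i t : ℝ)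

/-- The empirical `L²` distance of experts `i` and `j` over the rounds up to `t` where they are
jointly queried. -/
noncomputable def empDist {𝓨 : Type*} {K d : ℕ}
    (pair : ℕ → Fin K × Fin K) (z : ℕ → Round 𝓨 K d) (i j : Fin K) (t : ℕ) : ℝ :=
  Real.sqrt ((∑ s ∈ jointRounds pair i j t, ‖(z s).2 i - (z s).2 j‖ ^ 2) /
    (jointCount pair i j t : ℝ))

/-- `α_ij(t, δ_t)` with `δ_t = δ / (t (t + 1))`, meaningful when `T_ij(t) > 0`. -/
noncomputable def alpha {K : ℕ} (pair : ℕ → Fin K × Fin K) (δ : ℝ) (i j : Fin K) (t : ℕ) : ℝ :=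
  Real.sqrt (Real.log (4 * K * (δ / (t * (t + 1)))⁻¹) / (jointCount pair i j t : ℝ))

/-- The test statistic `Δ'_ij(t, δ)`, meaningful when `T_ij(t) > 0`. -/
noncomputable def testStat {𝓨 : Type*} {K d : ℕ} (loss : EuclideanSpace ℝ (Fin d) → 𝓨 → ℝ)
    (L ρ δ : ℝ) (pair : ℕ → Fin K × Fin K) (z : ℕ → Round 𝓨 K d) (i j : Fin K) (t : ℕ) : ℝ :=
  jointEmpLoss loss pair z i j j t - jointEmpLoss loss pair z i j i t
    - 6 * max (L * alpha pair δ i j t * empDist pair z i j t)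
        (lossBound L ρ * alpha pair δ i j t ^ 2)

/-- In round `t` the test of `i` against `j` reads `Δ'_ij > 0`, so that `j` is to be eliminated.
When `T_ij(t) = 0`, one has `α_ij = ∞` and the test never rejects. -/
def Rejects {𝓨 : Type*} {K d : ℕ} (loss : EuclideanSpace ℝ (Fin d) → 𝓨 → ℝ)
    (L ρ δ : ℝ) (pair : ℕ → Fin K × Fin K) (z : ℕ → Round 𝓨 K d) (i j : Fin K) (t : ℕ) : Prop :=
  0 < jointCount pair i j t ∧ 0 < testStat loss L ρ δ pair z i j t

open Classical in
/-- The set `S` of non-eliminated experts after round `t`. -/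
noncomputable def survivors {𝓨 : Type*} {K d : ℕ} (loss : EuclideanSpace ℝ (Fin d) → 𝓨 → ℝ)
    (L ρ δ : ℝ) (pair : ℕ → Fin K × Fin K) (z : ℕ → Round 𝓨 K d) : ℕ → Finset (Fin K)
  | 0 => Finset.univ
  | t + 1 => (survivors loss L ρ δ pair z t).filter
      fun v => ∀ u, ¬ Rejects loss L ρ δ pair z u v (t + 1)

/-- The querying rule: in each round `t + 1`, the queried pair belongs to `S × S` and minimizes
`T_uv(t)` over `(u, v) ∈ S × S`, ties being broken arbitrarily. Nothing is required once all
experts have been eliminated. -/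
def IsQueryingRun {𝓨 : Type*} {K d : ℕ} (loss : EuclideanSpace ℝ (Fin d) → 𝓨 → ℝ)
    (L ρ δ : ℝ) (pair : ℕ → Fin K × Fin K) (z : ℕ → Round 𝓨 K d) : Prop :=
  ∀ t, (survivors loss L ρ δ pair z t).Nonempty →
    (pair (t + 1)).1 ∈ survivors loss L ρ δ pair z t ∧
    (pair (t + 1)).2 ∈ survivors loss L ρ δ pair z t ∧
    ∀ u ∈ survivors loss L ρ δ pair z t, ∀ v ∈ survivors loss L ρ δ pair z t,
      jointCount pair (pair (t + 1)).1 (pair (t + 1)).2 t ≤ jointCount pair u v t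

/-- The experts `k`, `l`, `q` selected when the algorithm is interrupted after round `T`:
`k` is any element of `S`, `l` maximizes over `S` the empirical distance to `k` and is a second
expert, different from `k`, unless `S = {k}`, and `q` minimizes the empirical loss over `S`.
Nothing is required if all experts have been eliminated. -/
def IsSelection {𝓨 : Type*} {K d : ℕ} (loss : EuclideanSpace ℝ (Fin d) → 𝓨 → ℝ)
    (L ρ δ : ℝ) (pair : ℕ → Fin K × Fin K) (z : ℕ → Round 𝓨 K d) (T : ℕ)
    (k l q : Fin K) : Prop :=
  (survivors loss L ρ δ pair z T).Nonempty →
    k ∈ survivors loss L ρ δ pair z T ∧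
    l ∈ survivors loss L ρ δ pair z T ∧
    (∀ j ∈ survivors loss L ρ δ pair z T, empDist pair z k j T ≤ empDist pair z k l T) ∧
    (l = k → survivors loss L ρ δ pair z T = {k}) ∧
    q ∈ survivors loss L ρ δ pair z T ∧
    ∀ j ∈ survivors loss L ρ δ pair z T, empLoss loss pair z q T ≤ empLoss loss pair z j T

open Classical in
/-- The prediction rule returned after round `T`, as a function of the experts' forecasts: the mean
of the experts `k` and `l` if `T_kl > √(log (K T / δ) T_q)`, and expert `q` otherwise. -/
noncomputable def output {K d : ℕ} (δ : ℝ) (pair : ℕ → Fin K × Fin K) (T : ℕ) (k l q : Fin K)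
    (f : Fin K → EuclideanSpace ℝ (Fin d)) : EuclideanSpace ℝ (Fin d) :=
  if Real.sqrt (Real.log (K * T * δ⁻¹) * (queryCount pair q T : ℝ)) < (jointCount pair k l T : ℝ)
  then (1 / 2 : ℝ) • (f k + f l)
  else f q

/-- The data `Z 1, Z 2, ...` are i.i.d. rounds with law `P`, and the pair queried in round `t + 1`
is chosen from the past only: `𝓕 t` is the information after round `t`, it contains the data of the
rounds `1, ..., t` and possibly an independent randomization, round `t + 1` is independent of it,
and the pair of round `t + 1` is `𝓕 t`-measurable. -/
structure IsTraining {Ω 𝓨 : Type*} [MeasurableSpace 𝓨] {mΩ : MeasurableSpace Ω} {K d : ℕ}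
    (μ : Measure Ω) (P : Measure (Round 𝓨 K d)) (𝓕 : Filtration ℕ mΩ)
    (Z : ℕ → Ω → Round 𝓨 K d) (pair : ℕ → Ω → Fin K × Fin K) : Prop where
  data_measurable : ∀ t, Measurable[𝓕 (t + 1)] (Z (t + 1))
  data_law : ∀ t, μ.map (Z (t + 1)) = P
  data_indep : ∀ t, Indep (MeasurableSpace.comap (Z (t + 1)) inferInstance) (𝓕 t) μ
  pair_measurable : ∀ t, Measurable[𝓕 t] (pair (t + 1))

end ExpertAdvice

/-! On an event of probability at least `1 - 3δ` (`Concentrated`) all statistics used by the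
algorithm are accurate, and there the bound is deterministic.

Concentration. Rounds are selected adaptively, but whether a round is used is decided before its
data are seen. Products of exponentials over the selected rounds therefore have mean at most one
(`IsTraining.lintegral_prod_le_one`), and Markov's inequality gives the Chernoff bound of an i.i.d.
sample of deterministic size `n` (`IsTraining.measure_sum_ge_le`). A union bound over pairs and
sizes finishes. Loss differences are controlled at the Bernstein scale `L * d_ij`, and the unknown
`d_ij` is then replaced by its empirical version.

Elimination. On this event the best expert is never removed, and two survivors differ in risk by at
most a multiple of `max (L α d) (B α²)`, which is slow only when the experts are far apart. Strong
convexity makes the midpoint of two experts better than their average by `ρ² d² / 8`. Since `l` is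
the survivor farthest from `k`, the best expert is no farther from `k` than `l` is, so this gain
absorbs the term linear in `d` and leaves the fast rate `B log / T_kl`
(`Concentrated.risk_midpoint_sub_le`). Empirical risk minimization over survivors has the slow rate
`B √(log / T_q)` (`Concentrated.risk_erm_sub_le`).

Balance. Querying the least queried pair gives `T_kl ≳ T / K²` and `T_q ≳ T / K` for survivors. The
stopping test compares precisely the two rates, so the returned rule achieves their minimum
(`rate_bounds`). -/

namespace ExpertAdvice

/-! ### Counting queries -/

section Counting

variable {K : ℕ} (pair : ℕ → Fin K × Fin K)

theorem queryRounds_eq_jointRounds (i : Fin K) (t : ℕ) :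
    queryRounds pair i t = jointRounds pair i i t := by
  simp [queryRounds, jointRounds]

theorem queryCount_eq_jointCount (i : Fin K) (t : ℕ) :
    queryCount pair i t = jointCount pair i i t := by
  rw [queryCount, jointCount, queryRounds_eq_jointRounds]

theorem jointRounds_comm (i j : Fin K) (t : ℕ) :
    jointRounds pair i j t = jointRounds pair j i t := by
  simp only [jointRounds, and_comm]

theorem jointCount_comm (i j : Fin K) (t : ℕ) :
    jointCount pair i j t = jointCount pair j i t := by
  rw [jointCount, jointCount, jointRounds_comm]

theorem jointRounds_mono (i j : Fin K) : Monotone (jointRounds pair i j) := fun _ _ h =>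
  Finset.filter_subset_filter _ (Finset.Icc_subset_Icc le_rfl h)

theorem jointCount_mono (i j : Fin K) : Monotone (jointCount pair i j) := fun _ _ h =>
  Finset.card_le_card (jointRounds_mono pair i j h)

theorem jointCount_le (i j : Fin K) (t : ℕ) : jointCount pair i j t ≤ t :=
  (Finset.card_filter_le _ _).trans (by simp)

theorem card_filter_Icc_succ_le (p : ℕ → Prop) [DecidablePred p] (t : ℕ) :
    ((Finset.Icc 1 (t + 1)).filter p).card ≤ ((Finset.Icc 1 t).filter p).card + 1 := by
  rw [← Finset.insert_Icc_right_eq_Icc_add_one (by omega), Finset.filter_insert]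
  split_ifs
  · exact Finset.card_insert_le _ _
  · omega

/-- A counter which only moves when it is at most `M` never exceeds `M + 1`. -/
theorem card_filter_Icc_le_of_forall (p : ℕ → Prop) [DecidablePred p] (M T : ℕ)
    (h : ∀ s < T, p (s + 1) → ((Finset.Icc 1 s).filter p).card ≤ M) :
    ((Finset.Icc 1 T).filter p).card ≤ M + 1 := by
  induction T with
  | zero => simp
  | succ t ih =>
    by_cases hp : p (t + 1)
    · exact (card_filter_Icc_succ_le p t).trans (by have := h t (by omega) hp; omega)
    · rw [← Finset.insert_Icc_right_eq_Icc_add_one (by omega), Finset.filter_insert, if_neg hp]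
      exact ih fun s hs => h s (by omega)

/-- The number of rounds among `1, ..., t` in which exactly the ordered pair `p` is drawn. -/
def drawCount (p : Fin K × Fin K) (t : ℕ) : ℕ :=
  ((Finset.Icc 1 t).filter fun s => pair s = p).card

theorem drawCount_le_jointCount (p : Fin K × Fin K) (t : ℕ) :
    drawCount pair p t ≤ jointCount pair p.1 p.2 t := by
  apply Finset.card_le_card
  intro s hs
  simp only [Finset.mem_filter, jointRounds] at hs ⊢
  exact ⟨hs.1, by simp [hs.2]⟩

theorem drawCount_le_of_forall (p : Fin K × Fin K) (M T : ℕ)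
    (h : ∀ s < T, pair (s + 1) = p → jointCount pair p.1 p.2 s ≤ M) :
    drawCount pair p T ≤ M + 1 :=
  card_filter_Icc_le_of_forall _ M T fun s hs hp =>
    (drawCount_le_jointCount pair p s).trans (h s hs hp)

theorem sum_drawCount (T : ℕ) : ∑ p, drawCount pair p T = T := by
  have := Finset.card_eq_sum_card_fiberwise (f := pair) (s := Finset.Icc 1 T) (t := Finset.univ)
    (fun _ _ => Finset.mem_coe.2 (Finset.mem_univ _))
  simpa [drawCount] using this.symm

theorem sum_jointCount_le (u : Fin K) (T : ℕ) :
    ∑ a, jointCount pair u a T ≤ 2 * queryCount pair u T := by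
  have h1 : ∀ a, jointCount pair u a T =
      ∑ s ∈ queryRounds pair u T, if a = (pair s).1 ∨ a = (pair s).2 then 1 else 0 := by
    intro a
    rw [Finset.sum_boole, Nat.cast_id, queryRounds, Finset.filter_filter]
    rfl
  simp_rw [h1]
  rw [Finset.sum_comm, queryCount, mul_comm, ← smul_eq_mul]
  refine Finset.sum_le_card_nsmul _ _ _ fun s _ => ?_
  rw [Finset.sum_boole, Nat.cast_id]
  calc _ ≤ ({(pair s).1, (pair s).2} : Finset (Fin K)).card :=
        Finset.card_le_card fun a ha => by simpa using ha
    _ ≤ 2 := Finset.card_le_two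

theorem queryCount_le_sum_drawCount (q : Fin K) (T : ℕ) :
    queryCount pair q T ≤ ∑ w, (drawCount pair (q, w) T + drawCount pair (w, q) T) := by
  have : queryRounds pair q T ⊆ Finset.univ.biUnion fun w =>
      ((Finset.Icc 1 T).filter fun s => pair s = (q, w)) ∪
      ((Finset.Icc 1 T).filter fun s => pair s = (w, q)) := by
    intro s hs
    simp only [queryRounds, Finset.mem_filter] at hs
    simp only [Finset.mem_biUnion, Finset.mem_union, Finset.mem_filter, Finset.mem_univ, true_and]
    rcases hs with ⟨h, h' | h'⟩
    · exact ⟨(pair s).2, Or.inl ⟨h, by rw [h']⟩⟩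
    · exact ⟨(pair s).1, Or.inr ⟨h, by rw [h']⟩⟩
  exact (Finset.card_le_card this).trans (Finset.card_biUnion_le.trans
    (Finset.sum_le_sum fun w _ => Finset.card_union_le _ _))

end Counting

/-! ### Lower bounds on the query counts of surviving experts. -/

section Run

variable {𝓨 : Type*} {K d : ℕ} {loss : EuclideanSpace ℝ (Fin d) → 𝓨 → ℝ} {L ρ δ : ℝ}
  {pair : ℕ → Fin K × Fin K} {z : ℕ → Round 𝓨 K d} {T : ℕ} {u v : Fin K}

theorem survivors_antitone : Antitone (survivors loss L ρ δ pair z) :=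
  antitone_nat_of_succ_le fun _ => by classical exact Finset.filter_subset _ _

theorem IsQueryingRun.jointCount_le_of_mem (h : IsQueryingRun loss L ρ δ pair z)
    {s : ℕ} (hu : u ∈ survivors loss L ρ δ pair z s) (hv : v ∈ survivors loss L ρ δ pair z s) :
    jointCount pair (pair (s + 1)).1 (pair (s + 1)).2 s ≤ jointCount pair u v s :=
  (h s ⟨u, hu⟩).2.2 u hu v hv

theorem IsQueryingRun.drawCount_le (h : IsQueryingRun loss L ρ δ pair z)
    (hu : u ∈ survivors loss L ρ δ pair z T) (hv : v ∈ survivors loss L ρ δ pair z T)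
    (p : Fin K × Fin K) : drawCount pair p T ≤ jointCount pair u v T + 1 := by
  refine drawCount_le_of_forall pair p _ T fun s hs hp => ?_
  have := h.jointCount_le_of_mem (survivors_antitone hs.le hu) (survivors_antitone hs.le hv)
  rw [hp] at this
  exact this.trans (jointCount_mono pair u v hs.le)

/-- The expert `p.1` may be eliminated by time `T`, but it was alive whenever `p` was drawn. The
pair `(u, p.1)` was then a competitor of `p`, which bounds the counter of `p` at each such round. -/
theorem IsQueryingRun.drawCount_le_left (h : IsQueryingRun loss L ρ δ pair z)
    (hu : u ∈ survivors loss L ρ δ pair z T) (p : Fin K × Fin K) :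
    drawCount pair p T ≤ jointCount pair u p.1 T + 1 := by
  refine drawCount_le_of_forall pair p _ T fun s hs hp => ?_
  have hu' := survivors_antitone hs.le hu
  have := h.jointCount_le_of_mem hu' (h s ⟨u, hu'⟩).1
  rw [hp] at this
  exact this.trans (jointCount_mono pair u p.1 hs.le)

theorem IsQueryingRun.drawCount_le_right (h : IsQueryingRun loss L ρ δ pair z)
    (hu : u ∈ survivors loss L ρ δ pair z T) (p : Fin K × Fin K) :
    drawCount pair p T ≤ jointCount pair u p.2 T + 1 := by
  refine drawCount_le_of_forall pair p _ T fun s hs hp => ?_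
  have hu' := survivors_antitone hs.le hu
  have := h.jointCount_le_of_mem hu' (h s ⟨u, hu'⟩).2.1
  rw [hp] at this
  exact this.trans (jointCount_mono pair u p.2 hs.le)

theorem IsQueryingRun.le_sq_mul_jointCount (h : IsQueryingRun loss L ρ δ pair z)
    (hu : u ∈ survivors loss L ρ δ pair z T) (hv : v ∈ survivors loss L ρ δ pair z T) :
    T ≤ K ^ 2 * (jointCount pair u v T + 1) := by
  calc T = ∑ p, drawCount pair p T := (sum_drawCount pair T).symm
    _ ≤ Finset.card (Finset.univ : Finset (Fin K × Fin K)) • (jointCount pair u v T + 1) :=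
        Finset.sum_le_card_nsmul _ _ _ fun p _ => h.drawCount_le hu hv p
    _ = _ := by simp [sq]

/-- Comparing the draws of `(a, b)` with `T_ua` instead of a single `T_uv` saves a factor `K`: a
round that queries `u` contributes to at most two of the counts `T_ua`. The slow rate depends on
this linear dependence on `K`. -/
theorem IsQueryingRun.le_mul_queryCount (h : IsQueryingRun loss L ρ δ pair z)
    (hu : u ∈ survivors loss L ρ δ pair z T) : T ≤ K ^ 2 + 2 * K * queryCount pair u T := by
  calc T = ∑ p, drawCount pair p T := (sum_drawCount pair T).symm
    _ ≤ ∑ p : Fin K × Fin K, (jointCount pair u p.1 T + 1) :=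
        Finset.sum_le_sum fun p _ => h.drawCount_le_left hu p
    _ = K ^ 2 + K * ∑ a, jointCount pair u a T := by
        rw [Fintype.sum_prod_type]
        simp only [Finset.sum_const, Finset.card_univ, Fintype.card_fin, smul_eq_mul,
          ← Finset.mul_sum, Finset.sum_add_distrib]
        ring
    _ ≤ _ := by
        have := Nat.mul_le_mul_left K (sum_jointCount_le pair u T)
        linarith

/-- For distinct experts a joint query must draw exactly the unordered pair `{k, l}`, so the
minimality rule applies to every increment of the counter. For `k = l` this fails, since any pair
containing `k` increments `T_kk`. -/
theorem IsQueryingRun.jointCount_le_add_one (h : IsQueryingRun loss L ρ δ pair z)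
    (hu : u ∈ survivors loss L ρ δ pair z T) (hv : v ∈ survivors loss L ρ δ pair z T)
    {k l : Fin K} (hkl : k ≠ l) : jointCount pair k l T ≤ jointCount pair u v T + 1 := by
  refine card_filter_Icc_le_of_forall _ _ T fun s hs hp => ?_
  have h1 := (h.jointCount_le_of_mem (survivors_antitone hs.le hu)
    (survivors_antitone hs.le hv)).trans (jointCount_mono pair u v hs.le)
  change jointCount pair k l s ≤ _
  rcases hp with ⟨rfl | rfl, rfl | rfl⟩
  · exact absurd rfl hkl
  · exact h1
  · rwa [jointCount_comm]
  · exact absurd rfl hkl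

theorem IsQueryingRun.queryCount_le (h : IsQueryingRun loss L ρ δ pair z)
    (hu : u ∈ survivors loss L ρ δ pair z T) (q : Fin K) :
    queryCount pair q T ≤ 2 * K + 4 * queryCount pair u T := by
  calc queryCount pair q T ≤ _ := queryCount_le_sum_drawCount pair q T
    _ ≤ ∑ w, ((jointCount pair u w T + 1) + (jointCount pair u w T + 1)) :=
        Finset.sum_le_sum fun w _ =>
          add_le_add (h.drawCount_le_right hu (q, w)) (h.drawCount_le_left hu (w, q))
    _ = 2 * K + 2 * ∑ w, jointCount pair u w T := by
        simp only [Finset.sum_add_distrib, Finset.sum_const, Finset.card_univ, Fintype.card_fin,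
          smul_eq_mul]
        ring
    _ ≤ _ := by have := sum_jointCount_le pair u T; linarith

end Run

/-! ### Concentration under optional skipping -/

section Skipping

variable {Ω 𝓨 : Type*} [MeasurableSpace 𝓨] {mΩ : MeasurableSpace Ω} {K d : ℕ}
  {μ : Measure Ω} {P : Measure (Round 𝓨 K d)} {𝓕 : Filtration ℕ mΩ}
  {Z : ℕ → Ω → Round 𝓨 K d} {pair : ℕ → Ω → Fin K × Fin K}

/-- The partial products form a nonnegative supermartingale: on `A m`, known at time `m`, the new
factor is independent of the past and has mean at most one; off `A m` the product is unchanged.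
Adapted measurability is part of the induction because the independence step needs it. -/
theorem IsTraining.lintegral_prod_le_one [IsProbabilityMeasure μ]
    (h : IsTraining μ P 𝓕 Z pair)
    {G : Round 𝓨 K d → ENNReal} (hG : Measurable G) (hP : ∫⁻ z, G z ∂P ≤ 1)
    (A : ℕ → Set Ω) [∀ s, DecidablePred (· ∈ A s)] (hA : ∀ s, MeasurableSet[𝓕 s] (A s)) (m : ℕ) :
    Measurable[𝓕 m] (fun ω => ∏ s ∈ Finset.range m, if ω ∈ A s then G (Z (s + 1) ω) else 1) ∧
    ∫⁻ ω, ∏ s ∈ Finset.range m, (if ω ∈ A s then G (Z (s + 1) ω) else 1) ∂μ ≤ 1 := by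
  induction m with
  | zero => simp
  | succ m ih =>
    obtain ⟨ihm, ihi⟩ := ih
    set M : Ω → ENNReal := fun ω => ∏ s ∈ Finset.range m, if ω ∈ A s then G (Z (s + 1) ω) else 1
    have hMle : 𝓕 m ≤ mΩ := 𝓕.le m
    have hsucc : 𝓕 m ≤ 𝓕 (m + 1) := 𝓕.mono (Nat.le_succ m)
    simp_rw [Finset.prod_range_succ]
    refine ⟨(ihm.mono hsucc le_rfl).mul (Measurable.ite (hsucc _ (hA m))
      (hG.comp (h.data_measurable m)) measurable_const), ?_⟩
    have hZ : Measurable (Z (m + 1)) := (h.data_measurable m).mono (𝓕.le _) le_rfl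
    have h1 : ∫⁻ ω, G (Z (m + 1) ω) ∂μ ≤ 1 := by
      rw [← lintegral_map hG hZ, h.data_law]; exact hP
    have hMA : Measurable[𝓕 m] ((A m).indicator M) := ihm.indicator (hA m)
    calc ∫⁻ ω, M ω * (if ω ∈ A m then G (Z (m + 1) ω) else 1) ∂μ
        = ∫⁻ ω, ((A m).indicator M ω * G (Z (m + 1) ω) + (A m)ᶜ.indicator M ω) ∂μ := by
          refine lintegral_congr fun ω => ?_
          by_cases hω : ω ∈ A m <;> simp [hω]
      _ = ∫⁻ ω, (A m).indicator M ω * G (Z (m + 1) ω) ∂μ + ∫⁻ ω, (A m)ᶜ.indicator M ω ∂μ :=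
          lintegral_add_right _ ((ihm.mono hMle le_rfl).indicator (hMle _ (hA m)).compl)
      _ = (∫⁻ ω, (A m).indicator M ω ∂μ) * ∫⁻ ω, G (Z (m + 1) ω) ∂μ
            + ∫⁻ ω, (A m)ᶜ.indicator M ω ∂μ := by
          congr 1
          exact lintegral_mul_eq_lintegral_mul_lintegral_of_independent_measurableSpace hMle
            hZ.comap_le (h.data_indep m).symm hMA (hG.comp (comap_measurable _))
      _ ≤ (∫⁻ ω, (A m).indicator M ω ∂μ) + ∫⁻ ω, (A m)ᶜ.indicator M ω ∂μ := by
          gcongr; exact mul_le_of_le_one_right' h1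
      _ = ∫⁻ ω, M ω ∂μ := by
          rw [lintegral_indicator (hMle _ (hA m)), lintegral_indicator (hMle _ (hA m)).compl,
            lintegral_add_compl _ (hMle _ (hA m))]
      _ ≤ 1 := ihi

theorem IsTraining.measurable_jointCount (h : IsTraining μ P 𝓕 Z pair) (i j : Fin K) (s : ℕ) :
    Measurable[𝓕 s] fun ω => jointCount (fun t => pair t ω) i j s := by
  have : (fun ω => jointCount (fun t => pair t ω) i j s) = fun ω => ∑ r ∈ Finset.Icc 1 s,
      if (i = (pair r ω).1 ∨ i = (pair r ω).2) ∧ (j = (pair r ω).1 ∨ j = (pair r ω).2)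
        then 1 else 0 := by
    ext ω
    rw [Finset.sum_boole, Nat.cast_id]
    rfl
  rw [this]
  refine Finset.measurable_fun_sum _ fun r hr => ?_
  obtain ⟨r, rfl⟩ : ∃ r', r = r' + 1 := ⟨r - 1, by have := (Finset.mem_Icc.1 hr).1; omega⟩
  have hr' : r ≤ s := by have := (Finset.mem_Icc.1 hr).2; omega
  exact (measurable_of_countable fun p : Fin K × Fin K =>
    if (i = p.1 ∨ i = p.2) ∧ (j = p.1 ∨ j = p.2) then 1 else 0).comp
    ((h.pair_measurable r).mono (𝓕.mono hr') le_rfl)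

/-- The sum of `g` over the first `n` rounds in which `i` and `j` are jointly queried satisfies the
same Chernoff bound as a sum of `n` independent copies of `g`. -/
theorem IsTraining.measure_sum_ge_le [IsProbabilityMeasure μ] (h : IsTraining μ P 𝓕 Z pair)
    {g : Round 𝓨 K d → ℝ} (hg : Measurable g) (hP : ∫⁻ z, ENNReal.ofReal (Real.exp (g z)) ∂P ≤ 1)
    (i j : Fin K) (n T : ℕ) (x : ℝ) :
    μ {ω | ∃ t ≤ T, jointCount (fun t => pair t ω) i j t = n ∧
      x < ∑ s ∈ jointRounds (fun t => pair t ω) i j t, g (Z s ω)} ≤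
      ENNReal.ofReal (Real.exp (-x)) := by
  classical
  let J : Set (Fin K × Fin K) := {p | (i = p.1 ∨ i = p.2) ∧ (j = p.1 ∨ j = p.2)}
  -- Sampling stops after the `n`-th joint query. The single variable `M` then equals the
  -- exponential of the sum at every `t` with `T_ij(t) = n`, so one application of Markov's
  -- inequality treats all these times at once.
  let A : ℕ → Set Ω := fun s =>
    pair (s + 1) ⁻¹' J ∩ (fun ω => jointCount (fun t => pair t ω) i j s) ⁻¹' Set.Iio n
  have hA : ∀ s, MeasurableSet[𝓕 s] (A s) := fun s =>
    (h.pair_measurable s (MeasurableSet.of_discrete)).inter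
      (h.measurable_jointCount i j s (MeasurableSet.of_discrete))
  obtain ⟨hm, hi⟩ := h.lintegral_prod_le_one (hg.exp.ennreal_ofReal) hP A hA T
  set M : Ω → ENNReal := fun ω => ∏ s ∈ Finset.range T,
    if ω ∈ A s then ENNReal.ofReal (Real.exp (g (Z (s + 1) ω))) else 1
  have key : ∀ ω, ∀ t ≤ T, jointCount (fun t => pair t ω) i j t = n →
      M ω = ENNReal.ofReal (Real.exp (∑ s ∈ jointRounds (fun t => pair t ω) i j t, g (Z s ω))) := by
    intro ω t ht hn
    rw [Real.exp_sum, ENNReal.ofReal_prod_of_nonneg fun _ _ => (Real.exp_pos _).le]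
    change ∏ s ∈ Finset.range T,
      (if ω ∈ A s then ENNReal.ofReal (Real.exp (g (Z (s + 1) ω))) else 1) = _
    rw [← Finset.prod_filter]
    refine Finset.prod_bij (fun s _ => s + 1) ?_ (by simp) ?_ (fun _ _ => rfl)
    · intro s hs
      obtain ⟨_, h1, h2⟩ := Finset.mem_filter.1 hs
      have h3 : s < t := by
        by_contra! hts
        have := jointCount_mono (fun t => pair t ω) i j hts
        have h2' : jointCount (fun t => pair t ω) i j s < n := h2
        omega
      exact Finset.mem_filter.2 ⟨Finset.mem_Icc.2 ⟨by omega, by omega⟩, h1⟩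
    · intro r hr
      obtain ⟨h1, h2⟩ := Finset.mem_filter.1 hr
      rw [Finset.mem_Icc] at h1
      obtain ⟨s, rfl⟩ : ∃ r', r = r' + 1 := ⟨r - 1, by omega⟩
      refine ⟨s, Finset.mem_filter.2 ⟨Finset.mem_range.2 (by omega), h2, ?_⟩, rfl⟩
      change jointCount (fun t => pair t ω) i j s < n
      rw [← hn]
      refine Finset.card_lt_card (Finset.ssubset_iff_of_subset
        (jointRounds_mono _ i j (by omega : s ≤ t)) |>.2 ⟨s + 1, hr, ?_⟩)
      simp [jointRounds]
  have hsub : {ω | ∃ t ≤ T, jointCount (fun t => pair t ω) i j t = n ∧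
      x < ∑ s ∈ jointRounds (fun t => pair t ω) i j t, g (Z s ω)} ⊆
      {ω | ENNReal.ofReal (Real.exp x) ≤ M ω} := by
    rintro ω ⟨t, ht, hn, hx⟩
    rw [Set.mem_ofPred_eq, key ω t ht hn]
    exact ENNReal.ofReal_le_ofReal (Real.exp_le_exp.2 hx.le)
  have hmk := mul_meas_ge_le_lintegral (μ := μ) (hm.mono (𝓕.le _) le_rfl)
    (ENNReal.ofReal (Real.exp x))
  have hpos : ENNReal.ofReal (Real.exp x) ≠ 0 := by simp [Real.exp_pos]
  rw [Real.exp_neg, ENNReal.ofReal_inv_of_pos (Real.exp_pos _)]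
  refine (measure_mono hsub).trans ?_
  rw [ENNReal.le_inv_iff_mul_le, mul_comm]
  exact hmk.trans hi

end Skipping

/-! ### Exponential moments of bounded variables. -/

section ExpMoment

variable {α : Type*} [MeasurableSpace α] {P : Measure α} [IsProbabilityMeasure P]
  {X : α → ℝ} {c lam v : ℝ}

/-- Bernstein's argument: `exp x ≤ 1 + x + x²` for `|x| ≤ 1`, then integration and `1 + e ≤ exp e`.
The second moment replaces the range in the quadratic term, at the price of restricting `lam`. -/
theorem lintegral_exp_le_one_of_abs_le (hX : Measurable X) (hb : ∀ᵐ z ∂P, |X z| ≤ c)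
    (hlam : |lam| * c ≤ 1) (hv : ∫ z, X z ^ 2 ∂P ≤ v) :
    ∫⁻ z, ENNReal.ofReal (Real.exp (lam * X z - (lam * ∫ z, X z ∂P + lam ^ 2 * v))) ∂P ≤ 1 := by
  have hI : Integrable X P := .of_bound hX.aestronglyMeasurable c hb
  have hI2 : Integrable (fun z => X z ^ 2) P := by
    refine .of_bound (hX.pow_const 2).aestronglyMeasurable (c ^ 2) ?_
    filter_upwards [hb] with z hz
    rw [Real.norm_eq_abs, abs_pow]
    exact pow_le_pow_left₀ (abs_nonneg _) hz 2
  have hle : ∀ᵐ z ∂P, Real.exp (lam * X z) ≤ 1 + lam * X z + lam ^ 2 * X z ^ 2 := by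
    filter_upwards [hb] with z hz
    have : |lam * X z| ≤ 1 := by
      rw [abs_mul]; exact (mul_le_mul_of_nonneg_left hz (abs_nonneg _)).trans hlam
    have := (abs_le.1 (Real.abs_exp_sub_one_sub_id_le this)).2
    nlinarith
  have hIr : Integrable (fun z => 1 + lam * X z + lam ^ 2 * X z ^ 2) P :=
    ((integrable_const _).add (hI.const_mul _)).add (hI2.const_mul _)
  have hint : ∫ z, (1 + lam * X z + lam ^ 2 * X z ^ 2) ∂P
      = 1 + lam * ∫ z, X z ∂P + lam ^ 2 * ∫ z, X z ^ 2 ∂P := by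
    have h1 : Integrable (fun z => 1 + lam * X z) P := (integrable_const _).add (hI.const_mul _)
    rw [integral_add h1 (hI2.const_mul _), integral_add (integrable_const _) (hI.const_mul _),
      integral_const_mul, integral_const_mul]
    simp
  set e := lam * ∫ z, X z ∂P + lam ^ 2 * v
  calc ∫⁻ z, ENNReal.ofReal (Real.exp (lam * X z - e)) ∂P
      ≤ ∫⁻ z, ENNReal.ofReal (Real.exp (-e) * (1 + lam * X z + lam ^ 2 * X z ^ 2)) ∂P := by
        refine lintegral_mono_ae ?_
        filter_upwards [hle] with z hz
        refine ENNReal.ofReal_le_ofReal ?_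
        rw [sub_eq_neg_add, Real.exp_add]
        exact mul_le_mul_of_nonneg_left hz (Real.exp_pos _).le
    _ = ENNReal.ofReal (∫ z, Real.exp (-e) * (1 + lam * X z + lam ^ 2 * X z ^ 2) ∂P) := by
        refine (ofReal_integral_eq_lintegral_ofReal (hIr.const_mul _) ?_).symm
        filter_upwards [hle] with z hz
        exact mul_nonneg (Real.exp_pos _).le ((Real.exp_pos _).le.trans hz)
    _ ≤ 1 := by
        rw [integral_const_mul, hint, ← ENNReal.ofReal_one]
        refine ENNReal.ofReal_le_ofReal ?_
        rw [Real.exp_neg, inv_mul_le_iff₀ (Real.exp_pos _), mul_one]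
        refine le_trans ?_ (Real.add_one_le_exp e)
        have := mul_le_mul_of_nonneg_left hv (sq_nonneg lam)
        simp only [e]; linarith

/-- Hoeffding's lemma. -/
theorem lintegral_exp_le_one_of_abs_le' (hX : Measurable X) (hb : ∀ᵐ z ∂P, |X z| ≤ c)
    (lam : ℝ) :
    ∫⁻ z, ENNReal.ofReal (Real.exp (lam * X z - (lam * ∫ z, X z ∂P + lam ^ 2 * c ^ 2 / 2))) ∂P
      ≤ 1 := by
  have hS := hasSubgaussianMGF_of_mem_Icc (μ := P) (X := X) (a := -c) (b := c) hX.aemeasurable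
    (by filter_upwards [hb] with z hz using abs_le.1 hz)
  have hm := hS.mgf_le lam
  have hi := hS.integrable_exp_mul lam
  have hc : (((‖c - -c‖₊ / 2) ^ 2 : NNReal) : ℝ) = c ^ 2 := by
    push_cast
    rw [Real.norm_eq_abs, sub_neg_eq_add, ← two_mul, abs_mul, abs_two,
      mul_div_cancel_left₀ _ two_ne_zero, sq_abs]
  rw [hc, mgf] at hm
  set m := ∫ z, X z ∂P
  have : ∀ z, Real.exp (lam * X z - (lam * m + lam ^ 2 * c ^ 2 / 2))
      = Real.exp (-(c ^ 2 * lam ^ 2 / 2)) * Real.exp (lam * (X z - m)) := fun z => by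
    rw [← Real.exp_add]; congr 1; ring
  simp_rw [this]
  rw [← ofReal_integral_eq_lintegral_ofReal (hi.const_mul _) (ae_of_all _ fun z => by positivity),
    integral_const_mul, ← ENNReal.ofReal_one]
  refine ENNReal.ofReal_le_ofReal ?_
  rw [Real.exp_neg, inv_mul_le_iff₀ (Real.exp_pos _), mul_one]
  exact hm

end ExpMoment

/-! ### The confidence level -/

section Confidence

/-- `log (4 K / δ_n)` with `δ_n = δ / (n (n + 1))`. -/
noncomputable def logConf (K : ℕ) (δ : ℝ) (n : ℕ) : ℝ :=
  Real.log (4 * K * (δ / (n * (n + 1)))⁻¹)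

/-- The confidence radius after `n` observations. -/
noncomputable def radius (K : ℕ) (δ : ℝ) (n : ℕ) : ℝ := Real.sqrt (logConf K δ n / n)

variable {K : ℕ} {δ : ℝ} {n : ℕ}

theorem four_le_confidence (hK : 1 ≤ K) (hδ : 0 < δ) (hδ' : δ < 1) (hn : 0 < n) :
    4 ≤ 4 * K * (δ / (n * (n + 1) : ℝ))⁻¹ := by
  have hK' : (1 : ℝ) ≤ K := by exact_mod_cast hK
  have hn' : (1 : ℝ) ≤ n := by exact_mod_cast hn
  have : 1 ≤ (δ / (n * (n + 1) : ℝ))⁻¹ := by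
    rw [inv_div, one_le_div hδ]; nlinarith
  nlinarith

theorem logConf_pos (hK : 1 ≤ K) (hδ : 0 < δ) (hδ' : δ < 1) (hn : 0 < n) : 0 < logConf K δ n :=
  Real.log_pos (by linarith [four_le_confidence hK hδ hδ' hn])

theorem logConf_mono (hK : 1 ≤ K) (hδ : 0 < δ) (hδ' : δ < 1) (hn : 0 < n) {t : ℕ} (h : n ≤ t) :
    logConf K δ n ≤ logConf K δ t := by
  refine Real.log_le_log (by linarith [four_le_confidence hK hδ hδ' hn]) ?_
  have : (n : ℝ) ≤ t := by exact_mod_cast h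
  rw [inv_div, inv_div]
  gcongr

theorem radius_pos (hK : 1 ≤ K) (hδ : 0 < δ) (hδ' : δ < 1) (hn : 0 < n) : 0 < radius K δ n :=
  Real.sqrt_pos.2 (div_pos (logConf_pos hK hδ hδ' hn) (by exact_mod_cast hn))

theorem mul_radius_sq (hK : 1 ≤ K) (hδ : 0 < δ) (hδ' : δ < 1) (hn : 0 < n) :
    n * radius K δ n ^ 2 = logConf K δ n := by
  have hn' : (0 : ℝ) < n := by exact_mod_cast hn
  rw [radius, Real.sq_sqrt (div_pos (logConf_pos hK hδ hδ' hn) hn').le]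
  field_simp

/-- The union bound runs over sample sizes `n`, with level `δ_n`, whereas the algorithm uses `δ_t`.
Since `n ≤ t`, its radius is only larger. -/
theorem radius_le_alpha (hK : 1 ≤ K) (hδ : 0 < δ) (hδ' : δ < 1) (pair : ℕ → Fin K × Fin K)
    (i j : Fin K) (t : ℕ) (hn : 0 < jointCount pair i j t) :
    radius K δ (jointCount pair i j t) ≤ alpha pair δ i j t := by
  refine Real.sqrt_le_sqrt ?_
  gcongr
  exact logConf_mono hK hδ hδ' hn (jointCount_le pair i j t)

/-- The left side is `(δ_n / (4K))²`. The square produces the `K⁻²` needed for a union over ordered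
pairs, and the remaining factor `1 / (n (n + 1))` telescopes. -/
theorem exp_neg_two_logConf_le (hK : 1 ≤ K) (hδ : 0 < δ) (hδ' : δ < 1) (hn : 0 < n) :
    Real.exp (-(2 * logConf K δ n)) ≤ δ / (2 * K ^ 2) * (1 / n - 1 / (n + 1)) := by
  have hK' : (1 : ℝ) ≤ K := by exact_mod_cast hK
  have hn' : (1 : ℝ) ≤ n := by exact_mod_cast hn
  have h4 := four_le_confidence hK hδ hδ' hn
  have h1 : Real.exp (-(2 * logConf K δ n)) = ((δ / (n * (n + 1) : ℝ)) / (4 * K)) ^ 2 := by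
    rw [two_mul, neg_add, Real.exp_add, Real.exp_neg, logConf, Real.exp_log (by linarith)]
    field_simp
  rw [h1]
  have h2 : (1 : ℝ) / n - 1 / (n + 1) = 1 / (n * (n + 1)) := by field_simp; ring
  rw [h2, div_div, div_pow, div_mul_div_comm, div_le_div_iff₀ (by positivity) (by positivity)]
  have h3 : δ ^ 2 ≤ δ := by nlinarith
  have h5 : (n * (n + 1) : ℝ) ≤ (n * (n + 1)) ^ 2 := le_self_pow₀ (by nlinarith) two_ne_zero
  have h6 : (2 * K ^ 2 * (n * (n + 1)) : ℝ) ≤ (n * (n + 1) * (4 * K)) ^ 2 := by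
    rw [mul_pow, mul_pow]; nlinarith [sq_nonneg (K : ℝ)]
  calc δ ^ 2 * (2 * K ^ 2 * (n * (n + 1)) : ℝ) ≤ δ * (n * (n + 1) * (4 * K)) ^ 2 := by gcongr
    _ = _ := by ring

theorem sum_exp_neg_two_logConf_le (hK : 1 ≤ K) (hδ : 0 < δ) (hδ' : δ < 1) (T : ℕ) :
    ∑ n ∈ Finset.Icc 1 T, Real.exp (-(2 * logConf K δ n)) ≤ δ / (2 * K ^ 2) := by
  have h : ∀ T : ℕ, ∑ n ∈ Finset.Icc 1 T, ((1 : ℝ) / n - 1 / (n + 1)) = 1 - 1 / (T + 1) := by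
    intro T
    induction T with
    | zero => simp
    | succ T ih => rw [Finset.sum_Icc_succ_top (by omega), ih]; push_cast; ring
  calc _ ≤ ∑ n ∈ Finset.Icc 1 T, δ / (2 * K ^ 2) * ((1 : ℝ) / n - 1 / (n + 1)) :=
        Finset.sum_le_sum fun n hn =>
          exp_neg_two_logConf_le hK hδ hδ' (Finset.mem_Icc.1 hn).1
    _ = δ / (2 * K ^ 2) * (1 - 1 / (T + 1)) := by rw [← Finset.mul_sum, h]
    _ ≤ δ / (2 * K ^ 2) := by
        refine mul_le_of_le_one_right (by positivity) ?_
        have : (0 : ℝ) ≤ 1 / (T + 1) := by positivity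
        linarith

end Confidence

/-! ### Union bound over pairs of experts and sample sizes. -/

section Union

variable {Ω 𝓨 : Type*} [MeasurableSpace 𝓨] {mΩ : MeasurableSpace Ω} {K d : ℕ}
  {μ : Measure Ω} [IsProbabilityMeasure μ] {P : Measure (Round 𝓨 K d)} {𝓕 : Filtration ℕ mΩ}
  {Z : ℕ → Ω → Round 𝓨 K d} {pair : ℕ → Ω → Fin K × Fin K} {δ : ℝ}

/-- The sample path fails to concentrate for the family of test functions `g`, at some time
up to `T` and for some pair of experts. -/
def Deviates (g : ℕ → Fin K → Fin K → Round 𝓨 K d → ℝ) (δ : ℝ)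
    (pair : ℕ → Fin K × Fin K) (z : ℕ → Round 𝓨 K d) (T : ℕ) : Prop :=
  ∃ i j, ∃ t ≤ T, 0 < jointCount pair i j t ∧
    2 * logConf K δ (jointCount pair i j t) <
      ∑ s ∈ jointRounds pair i j t, g (jointCount pair i j t) i j (z s)

theorem IsTraining.measure_deviates_le (h : IsTraining μ P 𝓕 Z pair)
    (hK : 1 ≤ K) (hδ : 0 < δ) (hδ' : δ < 1) (T : ℕ)
    {g : ℕ → Fin K → Fin K → Round 𝓨 K d → ℝ} (hg : ∀ n i j, Measurable (g n i j))
    (hP : ∀ n i j, 0 < n → ∫⁻ z, ENNReal.ofReal (Real.exp (g n i j z)) ∂P ≤ 1) :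
    μ {ω | Deviates g δ (fun t => pair t ω) (fun t => Z t ω) T} ≤ ENNReal.ofReal (δ / 2) := by
  have hsub : {ω | Deviates g δ (fun t => pair t ω) (fun t => Z t ω) T} ⊆
      ⋃ p ∈ (Finset.univ : Finset (Fin K × Fin K)), ⋃ n ∈ Finset.Icc 1 T,
        {ω | ∃ t ≤ T, jointCount (fun t => pair t ω) p.1 p.2 t = n ∧ 2 * logConf K δ n <
          ∑ s ∈ jointRounds (fun t => pair t ω) p.1 p.2 t, g n p.1 p.2 (Z s ω)} := by
    rintro ω ⟨i, j, t, ht, h0, hx⟩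
    simp only [Set.mem_iUnion]
    exact ⟨(i, j), Finset.mem_univ _, jointCount (fun t => pair t ω) i j t,
      Finset.mem_Icc.2 ⟨h0, (jointCount_le _ i j t).trans ht⟩, t, ht, rfl, hx⟩
  calc _ ≤ _ := measure_mono hsub
    _ ≤ ∑ p : Fin K × Fin K, ∑ n ∈ Finset.Icc 1 T, μ {ω | ∃ t ≤ T,
          jointCount (fun t => pair t ω) p.1 p.2 t = n ∧ 2 * logConf K δ n <
          ∑ s ∈ jointRounds (fun t => pair t ω) p.1 p.2 t, g n p.1 p.2 (Z s ω)} :=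
        (measure_biUnion_finset_le _ _).trans
          (Finset.sum_le_sum fun p _ => measure_biUnion_finset_le _ _)
    _ ≤ ∑ p : Fin K × Fin K, ∑ n ∈ Finset.Icc 1 T,
          ENNReal.ofReal (Real.exp (-(2 * logConf K δ n))) :=
        Finset.sum_le_sum fun p _ => Finset.sum_le_sum fun n hn =>
          h.measure_sum_ge_le (hg n _ _) (hP n _ _ (Finset.mem_Icc.1 hn).1) p.1 p.2 n T _
    _ = (K * K : ENNReal) *
          ENNReal.ofReal (∑ n ∈ Finset.Icc 1 T, Real.exp (-(2 * logConf K δ n))) := by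
        rw [ENNReal.ofReal_sum_of_nonneg fun _ _ => (Real.exp_pos _).le]
        simp
    _ ≤ (K * K : ENNReal) * ENNReal.ofReal (δ / (2 * K ^ 2)) := by
        gcongr
        exact sum_exp_neg_two_logConf_le hK hδ hδ' T
    _ = ENNReal.ofReal (δ / 2) := by
        have hK' : (1 : ℝ) ≤ K := by exact_mod_cast hK
        rw [← ENNReal.ofReal_natCast, ← ENNReal.ofReal_mul (by positivity),
          ← ENNReal.ofReal_mul (by positivity)]
        congr 1
        field_simp

end Union

/-! ### Consequences of combining the Lipschitz property with strong convexity. -/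

section Geometry

variable {𝓨 : Type*} {d : ℕ} {X : Set (EuclideanSpace ℝ (Fin d))}
  {loss : EuclideanSpace ℝ (Fin d) → 𝓨 → ℝ} {L ρ : ℝ}

/-- `b = 16 L² / ρ⁴`, a bound for the squared diameter of `X`. -/
noncomputable def sqDiamBound (L ρ : ℝ) : ℝ := 16 * L ^ 2 / ρ ^ 4

theorem LipschitzStronglyConvex.midpoint_le (h : LipschitzStronglyConvex X loss L ρ) (y : 𝓨)
    {x x' : EuclideanSpace ℝ (Fin d)} (hx : x ∈ X) (hx' : x' ∈ X) :
    loss ((1 / 2 : ℝ) • (x + x')) y ≤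
      (loss x y + loss x' y) / 2 - ρ ^ 2 / 8 * ‖x - x'‖ ^ 2 := by
  have := (h.strongConvex y).2 hx hx' (by norm_num : (0 : ℝ) ≤ 1 / 2)
    (by norm_num : (0 : ℝ) ≤ 1 / 2) (by norm_num)
  rw [← smul_add, smul_eq_mul, smul_eq_mul] at this
  linarith

/-- At the midpoint, strong convexity forces a drop of at least `ρ² ‖x - x'‖² / 8` below the average
of the endpoint values, while the Lipschitz property allows at most `L ‖x - x'‖ / 2`. -/
theorem LipschitzStronglyConvex.norm_sub_le (h : LipschitzStronglyConvex X loss L ρ) (y : 𝓨)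
    (hL : 0 ≤ L) {x x' : EuclideanSpace ℝ (Fin d)} (hx : x ∈ X) (hx' : x' ∈ X) :
    ρ ^ 2 * ‖x - x'‖ ≤ 4 * L := by
  have hmem : (1 / 2 : ℝ) • (x + x') ∈ X := by
    rw [smul_add]
    exact (h.strongConvex y).1 hx hx' (by norm_num) (by norm_num) (by norm_num)
  have h1 := h.midpoint_le y hx hx'
  have h2 := (abs_le.1 (h.lipschitz y _ hx _ hmem)).2
  have h3 := (abs_le.1 (h.lipschitz y _ hx' _ hmem)).2
  have e1 : x - (1 / 2 : ℝ) • (x + x') = (1 / 2 : ℝ) • (x - x') := by module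
  have e2 : x' - (1 / 2 : ℝ) • (x + x') = (-1 / 2 : ℝ) • (x - x') := by module
  rw [e1, norm_smul, show ‖(1 / 2 : ℝ)‖ = 1 / 2 by norm_num] at h2
  rw [e2, norm_smul, show ‖(-1 / 2 : ℝ)‖ = 1 / 2 by norm_num] at h3
  rcases (norm_nonneg (x - x')).eq_or_lt with h0 | h0
  · rw [← h0, mul_zero]; positivity
  · refine le_of_mul_le_mul_right ?_ h0
    nlinarith

theorem LipschitzStronglyConvex.norm_sub_sq_le (h : LipschitzStronglyConvex X loss L ρ) (y : 𝓨)
    (hL : 0 ≤ L) (hρ : 0 < ρ) {x x' : EuclideanSpace ℝ (Fin d)} (hx : x ∈ X) (hx' : x' ∈ X) :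
    ‖x - x'‖ ^ 2 ≤ sqDiamBound L ρ := by
  have h1 := h.norm_sub_le y hL hx hx'
  rw [sqDiamBound, le_div_iff₀ (by positivity)]
  have := pow_le_pow_left₀ (by positivity) h1 2
  nlinarith

theorem sq_mul_sqDiamBound (hρ : 0 < ρ) : ρ ^ 2 * sqDiamBound L ρ = 2 * lossBound L ρ := by
  rw [sqDiamBound, lossBound]; field_simp; ring

theorem sq_lip_mul_sqDiamBound (hρ : 0 < ρ) :
    L ^ 2 * sqDiamBound L ρ = lossBound L ρ ^ 2 / 4 := by
  rw [sqDiamBound, lossBound]; field_simp; ring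

theorem LipschitzStronglyConvex.lip_mul_norm_sub_le (h : LipschitzStronglyConvex X loss L ρ)
    (y : 𝓨) (hL : 0 ≤ L) (hρ : 0 < ρ) {x x' : EuclideanSpace ℝ (Fin d)}
    (hx : x ∈ X) (hx' : x' ∈ X) : L * ‖x - x'‖ ≤ lossBound L ρ / 2 := by
  have h1 := mul_le_mul_of_nonneg_left (h.norm_sub_le y hL hx hx') hL
  rw [lossBound, div_div, le_div_iff₀ (by positivity)]
  nlinarith

end Geometry

/-! ### The event on which all the statistics concentrate -/

section Test

variable {α : Type*} [MeasurableSpace α]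

/-- The exponent in the Chernoff bound for `X`, with parameter `lam` and variance proxy `2 v`. -/
noncomputable def expTest (P : Measure α) (X : α → ℝ) (lam v : ℝ) (z : α) : ℝ :=
  lam * X z - (lam * ∫ z, X z ∂P + lam ^ 2 * v)

theorem measurable_expTest {P : Measure α} {X : α → ℝ} (hX : Measurable X) (lam v : ℝ) :
    Measurable (expTest P X lam v) :=
  (hX.const_mul lam).sub_const _

variable {𝓨 : Type*} [MeasurableSpace 𝓨] {K d : ℕ} {P : Measure (Round 𝓨 K d)} {δ : ℝ}
  {pair : ℕ → Fin K × Fin K} {z : ℕ → Round 𝓨 K d} {T : ℕ}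

theorem mean_le_of_not_deviates (hK : 1 ≤ K) (hδ : 0 < δ) (hδ' : δ < 1)
    {X : Fin K → Fin K → Round 𝓨 K d → ℝ} {lam v : ℕ → Fin K → Fin K → ℝ}
    (h : ¬ Deviates (fun n i j => expTest P (X i j) (lam n i j) (v n i j)) δ pair z T)
    {i j : Fin K} {t n : ℕ} (ht : t ≤ T) (hn : jointCount pair i j t = n) (hpos : 0 < n) :
    lam n i j * ((∑ s ∈ jointRounds pair i j t, X i j (z s)) / n) ≤
      lam n i j * ∫ z, X i j z ∂P + lam n i j ^ 2 * v n i j + 2 * radius K δ n ^ 2 := by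
  have hn' : (0 : ℝ) < n := by exact_mod_cast hpos
  have h1 : ∑ s ∈ jointRounds pair i j t, expTest P (X i j) (lam n i j) (v n i j) (z s) ≤
      2 * logConf K δ n := by
    by_contra! hlt
    exact h ⟨i, j, t, ht, hn ▸ hpos, by simpa only [hn] using hlt⟩
  rw [← mul_radius_sq hK hδ hδ' hpos] at h1
  simp only [expTest, Finset.sum_sub_distrib, ← Finset.mul_sum, Finset.sum_const,
    nsmul_eq_mul] at h1
  change _ - (jointCount pair i j t : ℝ) * _ ≤ _ at h1
  rw [hn] at h1
  rw [← mul_div_assoc, div_le_iff₀ hn']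
  linarith

end Test

/-- The mean squared distance of the forecasts of the experts `i` and `j`. -/
noncomputable def meanSqDist {𝓨 : Type*} [MeasurableSpace 𝓨] {K d : ℕ}
    (P : Measure (Round 𝓨 K d)) (i j : Fin K) : ℝ := ∫ z, ‖z.2 i - z.2 j‖ ^ 2 ∂P

/-- All the empirical statistics of the sample path are close to their means up to time `T`. -/
structure Concentrated {𝓨 : Type*} [MeasurableSpace 𝓨] {K d : ℕ}
    (loss : EuclideanSpace ℝ (Fin d) → 𝓨 → ℝ) (L ρ δ : ℝ) (P : Measure (Round 𝓨 K d))
    (pair : ℕ → Fin K × Fin K) (z : ℕ → Round 𝓨 K d) (T : ℕ) : Prop where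
  excess : ∀ i j, ∀ t ≤ T, 0 < jointCount pair i j t →
    (jointEmpLoss loss pair z i j j t - jointEmpLoss loss pair z i j i t) -
      (risk loss P (fun f => f j) - risk loss P (fun f => f i)) ≤
      6 * max (L * alpha pair δ i j t * empDist pair z i j t)
        (lossBound L ρ * alpha pair δ i j t ^ 2)
  dist : ∀ i j, 0 < jointCount pair i j T →
    empDist pair z i j T ^ 2 ≤
      2 * meanSqDist P i j + 2 * sqDiamBound L ρ * alpha pair δ i j T ^ 2
  emp : ∀ i, 0 < queryCount pair i T →
    |empLoss loss pair z i T - risk loss P (fun f => f i)| ≤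
      2 * lossBound L ρ * alpha pair δ i i T

/-- With Chernoff parameter `a / w` and `w ≥ L √v`, the quadratic term is at most `a²`, so `dev ≤ 3
a w`. The bound on `v` by the empirical distance `dh` costs another factor two, `w ≤ 2 * max (L *
dh) (B * a)`, whence the six of the test statistic. -/
theorem six_mul_max_bound {a L B b v dh dev w : ℝ} (ha : 0 < a) (hL : 0 ≤ L) (hB : 0 < B)
    (hb : L ^ 2 * b = B ^ 2 / 4) (hv : 0 ≤ v) (hdh : 0 ≤ dh)
    (hvd : v ≤ 2 * dh ^ 2 + 8 * b * a ^ 2) (hw : w = max (L * √v) (B * a / 2))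
    (hdev : a / w * dev ≤ (a / w) ^ 2 * (L ^ 2 * v) + 2 * a ^ 2) :
    dev ≤ 6 * max (L * a * dh) (B * a ^ 2) := by
  have hw0 : 0 < w := hw ▸ lt_max_of_lt_right (by positivity)
  have hvw : L ^ 2 * v ≤ w ^ 2 := by
    calc L ^ 2 * v = (L * √v) ^ 2 := by rw [mul_pow, Real.sq_sqrt hv]
      _ ≤ w ^ 2 := pow_le_pow_left₀ (by positivity) (hw ▸ le_max_left _ _) 2
  have h1 : dev ≤ 3 * a * w := by
    have e : (a / w) ^ 2 * (L ^ 2 * v) ≤ a ^ 2 := by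
      rw [div_pow, div_mul_eq_mul_div, div_le_iff₀ (by positivity)]
      gcongr
    have h2 : a / w * dev ≤ a / w * (3 * a * w) := by
      calc a / w * dev ≤ 3 * a ^ 2 := by linarith
        _ = _ := by field_simp
    exact le_of_mul_le_mul_left h2 (by positivity)
  set m := max (L * dh) (B * a) with hm
  have hm0 : 0 ≤ m := le_max_of_le_right (by positivity)
  have hwm : w ≤ 2 * m := by
    rw [hw]
    refine max_le (abs_le_of_sq_le_sq' ?_ (by positivity)).2 ?_
    · have e1 : (L * dh) ^ 2 ≤ m ^ 2 := pow_le_pow_left₀ (by positivity) (le_max_left _ _) 2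
      have e2 : (B * a) ^ 2 ≤ m ^ 2 := pow_le_pow_left₀ (by positivity) (le_max_right _ _) 2
      rw [mul_pow, Real.sq_sqrt hv]
      have e3 := mul_le_mul_of_nonneg_left hvd (sq_nonneg L)
      have e4 : L ^ 2 * (2 * dh ^ 2 + 8 * b * a ^ 2) = 2 * (L * dh) ^ 2 + 2 * (B * a) ^ 2 := by
        linear_combination 8 * a ^ 2 * hb
      nlinarith
    · have : B * a ≤ m := le_max_right _ _
      have : 0 < B * a := by positivity
      linarith
  have ham : a * m = max (L * a * dh) (B * a ^ 2) := by
    rw [hm, mul_max_of_nonneg _ _ ha.le]; congr 1 <;> ring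
  rw [← ham]
  nlinarith

theorem empDist_sq {𝓨 : Type*} {K d : ℕ} (pair : ℕ → Fin K × Fin K) (z : ℕ → Round 𝓨 K d) (i j : Fin K) (t : ℕ) :
    empDist pair z i j t ^ 2 =
      (∑ s ∈ jointRounds pair i j t, ‖(z s).2 i - (z s).2 j‖ ^ 2) / (jointCount pair i j t) :=
  Real.sq_sqrt (by positivity)

section Event

variable {Ω 𝓨 : Type*} [MeasurableSpace 𝓨] {mΩ : MeasurableSpace Ω} {K d : ℕ}
  {μ : Measure Ω} {P : Measure (Round 𝓨 K d)} {𝓕 : Filtration ℕ mΩ}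
  {Z : ℕ → Ω → Round 𝓨 K d} {pair : ℕ → Ω → Fin K × Fin K}
  {X : Set (EuclideanSpace ℝ (Fin d))}
  {loss : EuclideanSpace ℝ (Fin d) → 𝓨 → ℝ} {L ρ δ : ℝ}

theorem measurable_loss_expert (hl : Measurable (Function.uncurry loss)) (i : Fin K) :
    Measurable fun z : Round 𝓨 K d => loss (z.2 i) z.1 :=
  hl.comp (f := fun z : Round 𝓨 K d => (z.2 i, z.1)) (by fun_prop)

theorem measurable_normSq_sub (i j : Fin K) :
    Measurable fun z : Round 𝓨 K d => ‖z.2 i - z.2 j‖ ^ 2 := by fun_prop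

/-- The scale `max (L d_ij) (B a_n / 2)` of the loss difference of `i` and `j`. -/
noncomputable def lossScale (P : Measure (Round 𝓨 K d)) (L ρ δ : ℝ) (n : ℕ) (i j : Fin K) : ℝ :=
  max (L * √(meanSqDist P i j)) (lossBound L ρ * radius K δ n / 2)

theorem meanSqDist_nonneg (i j : Fin K) : 0 ≤ meanSqDist P i j :=
  integral_nonneg fun _ => by positivity

theorem integrable_loss [IsProbabilityMeasure P] (hl : Measurable (Function.uncurry loss))
    (hbd : ∀ y, ∀ x ∈ X, |loss x y| ≤ lossBound L ρ) (hPX : ∀ᵐ z ∂P, ∀ i, z.2 i ∈ X)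
    (i : Fin K) : Integrable (fun z : Round 𝓨 K d => loss (z.2 i) z.1) P :=
  .of_bound (measurable_loss_expert hl i).aestronglyMeasurable (lossBound L ρ)
    (by filter_upwards [hPX] with z hz using hbd _ _ (hz i))

theorem integrable_normSq_sub [IsProbabilityMeasure P] (hL : 0 ≤ L) (hρ : 0 < ρ)
    (hc : LipschitzStronglyConvex X loss L ρ) (hPX : ∀ᵐ z ∂P, ∀ i, z.2 i ∈ X)
    (i j : Fin K) : Integrable (fun z : Round 𝓨 K d => ‖z.2 i - z.2 j‖ ^ 2) P :=
  .of_bound (measurable_normSq_sub i j).aestronglyMeasurable (sqDiamBound L ρ) (by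
    filter_upwards [hPX] with z hz
    rw [Real.norm_eq_abs, abs_of_nonneg (by positivity)]
    exact hc.norm_sub_sq_le z.1 hL hρ (hz i) (hz j))

/-- A loss difference is bounded by `B / 2` and has second moment at most `L² d_ij²`. The floor `B
a_n / 2` in `lossScale` is what keeps the parameter in the range of Bernstein's bound. -/
theorem lintegral_exp_expTest_lossDiff [IsProbabilityMeasure P]
    (hl : Measurable (Function.uncurry loss)) (hL : 0 < L) (hρ : 0 < ρ)
    (hc : LipschitzStronglyConvex X loss L ρ) (hPX : ∀ᵐ z ∂P, ∀ i, z.2 i ∈ X)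
    (i j : Fin K) {n : ℕ} (hr : 0 < radius K δ n) :
    ∫⁻ z, ENNReal.ofReal (Real.exp (expTest P
      (fun z => loss (z.2 j) z.1 - loss (z.2 i) z.1)
      (radius K δ n / lossScale P L ρ δ n i j) (L ^ 2 * meanSqDist P i j) z)) ∂P ≤ 1 := by
  have hB : 0 < lossBound L ρ := by rw [lossBound]; positivity
  have hlip : ∀ᵐ z ∂P, |loss (z.2 j) z.1 - loss (z.2 i) z.1| ≤ L * ‖z.2 i - z.2 j‖ := by
    filter_upwards [hPX] with z hz
    rw [norm_sub_rev]
    exact hc.lipschitz z.1 _ (hz j) _ (hz i)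
  refine lintegral_exp_le_one_of_abs_le (c := lossBound L ρ / 2)
    ((measurable_loss_expert hl j).sub (measurable_loss_expert hl i)) ?_ ?_ ?_
  · filter_upwards [hPX, hlip] with z hz h1
    exact h1.trans (hc.lip_mul_norm_sub_le z.1 hL.le hρ (hz i) (hz j))
  · have h0 : lossBound L ρ * radius K δ n / 2 ≤ lossScale P L ρ δ n i j := le_max_right _ _
    have hw : 0 < lossScale P L ρ δ n i j := lt_of_lt_of_le (by positivity) h0
    rw [abs_of_pos (by positivity), div_mul_eq_mul_div, div_le_one hw]
    linarith
  · rw [meanSqDist, ← integral_const_mul]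
    refine integral_mono_of_nonneg (ae_of_all _ fun _ => sq_nonneg _)
      ((integrable_normSq_sub hL.le hρ hc hPX i j).const_mul _) ?_
    filter_upwards [hlip] with z hz
    have := pow_le_pow_left₀ (abs_nonneg _) hz 2
    rwa [sq_abs, mul_pow] at this

/-- Squared distances lie in `[0, b]`, so their second moment is at most `b` times their mean. This
self-bounding property gives multiplicative comparisons between empirical and true distances. -/
theorem lintegral_exp_expTest_normSq [IsProbabilityMeasure P] (hL : 0 < L) (hρ : 0 < ρ)
    (hc : LipschitzStronglyConvex X loss L ρ) (hPX : ∀ᵐ z ∂P, ∀ i, z.2 i ∈ X)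
    (i j : Fin K) {lam : ℝ} (hlam : |lam| * sqDiamBound L ρ ≤ 1) :
    ∫⁻ z, ENNReal.ofReal (Real.exp (expTest P (fun z => ‖z.2 i - z.2 j‖ ^ 2) lam
      (sqDiamBound L ρ * meanSqDist P i j) z)) ∂P ≤ 1 := by
  refine lintegral_exp_le_one_of_abs_le (measurable_normSq_sub i j) ?_ hlam ?_
  · filter_upwards [hPX] with z hz
    rw [abs_of_nonneg (by positivity)]
    exact hc.norm_sub_sq_le z.1 hL.le hρ (hz i) (hz j)
  · rw [meanSqDist, ← integral_const_mul]
    refine integral_mono_of_nonneg (ae_of_all _ fun _ => sq_nonneg _)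
      ((integrable_normSq_sub hL.le hρ hc hPX i j).const_mul _) ?_
    filter_upwards [hPX] with z hz
    have := hc.norm_sub_sq_le z.1 hL.le hρ (hz i) (hz j)
    exact (sq (‖z.2 i - z.2 j‖ ^ 2)).trans_le (by gcongr)

theorem concentrated_of_not_deviates [IsProbabilityMeasure P]
    {pair : ℕ → Fin K × Fin K} {z : ℕ → Round 𝓨 K d} {T : ℕ}
    (hK : 1 ≤ K) (hδ : 0 < δ) (hδ' : δ < 1)
    (hl : Measurable (Function.uncurry loss)) (hL : 0 < L) (hρ : 0 < ρ)
    (hbd : ∀ y, ∀ x ∈ X, |loss x y| ≤ lossBound L ρ) (hPX : ∀ᵐ z ∂P, ∀ i, z.2 i ∈ X)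
    (h1 : ¬ Deviates (fun n i j => expTest P (fun z => loss (z.2 j) z.1 - loss (z.2 i) z.1)
      (radius K δ n / lossScale P L ρ δ n i j) (L ^ 2 * meanSqDist P i j)) δ pair z T)
    (h2 : ¬ Deviates (fun _ i j => expTest P (fun z => ‖z.2 i - z.2 j‖ ^ 2)
      (-(1 / (2 * sqDiamBound L ρ))) (sqDiamBound L ρ * meanSqDist P i j)) δ pair z T)
    (h3 : ¬ Deviates (fun _ i j => expTest P (fun z => ‖z.2 i - z.2 j‖ ^ 2)
      (1 / sqDiamBound L ρ) (sqDiamBound L ρ * meanSqDist P i j)) δ pair z T)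
    (h4 : ¬ Deviates (fun n i _ => expTest P (fun z => loss (z.2 i) z.1)
      (2 * radius K δ n / lossBound L ρ) (lossBound L ρ ^ 2 / 2)) δ pair z T)
    (h5 : ¬ Deviates (fun n i _ => expTest P (fun z => loss (z.2 i) z.1)
      (-(2 * radius K δ n / lossBound L ρ)) (lossBound L ρ ^ 2 / 2)) δ pair z T) :
    Concentrated loss L ρ δ P pair z T := by
  have hB : 0 < lossBound L ρ := by rw [lossBound]; positivity
  have hb : 0 < sqDiamBound L ρ := by rw [sqDiamBound]; positivity
  have hI := integrable_loss hl hbd hPX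
  constructor
  · intro i j t ht hn
    obtain ⟨n, hn'⟩ : ∃ n, jointCount pair i j t = n := ⟨_, rfl⟩
    have hr := radius_le_alpha hK hδ hδ' pair i j t hn
    rw [hn'] at hn hr
    have ha := radius_pos hK hδ hδ' hn
    have e1 := mean_le_of_not_deviates hK hδ hδ' h1 ht hn' hn
    have e2 := mean_le_of_not_deviates hK hδ hδ' h2 ht hn' hn
    have hdist := empDist_sq pair z i j t
    rw [hn'] at hdist
    rw [← hdist, ← meanSqDist] at e2
    rw [integral_sub (hI j) (hI i), Finset.sum_sub_distrib] at e1
    simp only [jointEmpLoss, risk, hn']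
    -- The parameter `-1 / (2b)` makes the quadratic term half of the linear one, so half of the
    -- mean survives on the left.
    have hvd : meanSqDist P i j ≤ 2 * empDist pair z i j t ^ 2 +
        8 * sqDiamBound L ρ * radius K δ n ^ 2 := by
      field_simp at e2
      linarith
    have hs := six_mul_max_bound ha hL.le hB (sq_lip_mul_sqDiamBound hρ) (meanSqDist_nonneg i j)
      (Real.sqrt_nonneg _) hvd rfl (dev := _) (by
        rw [mul_sub]
        exact sub_le_iff_le_add'.2 (by rw [← add_assoc]; exact e1))
    rw [← sub_div]
    refine hs.trans ?_
    have hd0 : 0 ≤ empDist pair z i j t := Real.sqrt_nonneg _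
    change 6 * max (L * radius K δ n * empDist pair z i j t) _ ≤ _
    gcongr
  · intro i j hn
    obtain ⟨n, hn'⟩ : ∃ n, jointCount pair i j T = n := ⟨_, rfl⟩
    have hr := radius_le_alpha hK hδ hδ' pair i j T hn
    rw [hn'] at hn hr
    have ha := radius_pos hK hδ hδ' hn
    have e3 := mean_le_of_not_deviates hK hδ hδ' h3 le_rfl hn' hn
    have hdist := empDist_sq pair z i j T
    rw [hn'] at hdist
    rw [← hdist, ← meanSqDist] at e3
    have : empDist pair z i j T ^ 2 ≤
        2 * meanSqDist P i j + 2 * sqDiamBound L ρ * radius K δ n ^ 2 := by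
      field_simp at e3
      linarith
    refine this.trans ?_
    gcongr
  · intro i hn
    rw [queryCount_eq_jointCount] at hn
    obtain ⟨n, hn'⟩ : ∃ n, jointCount pair i i T = n := ⟨_, rfl⟩
    have hr := radius_le_alpha hK hδ hδ' pair i i T hn
    rw [hn'] at hn hr
    have ha := radius_pos hK hδ hδ' hn
    have e4 := mean_le_of_not_deviates hK hδ hδ' h4 le_rfl hn' hn
    have e5 := mean_le_of_not_deviates hK hδ hδ' h5 le_rfl hn' hn
    rw [empLoss, queryCount_eq_jointCount, queryRounds_eq_jointRounds, hn', risk]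
    set S := (∑ s ∈ jointRounds pair i i T, loss ((z s).2 i) (z s).1) / (n : ℝ)
    set R := ∫ z : Round 𝓨 K d, loss (z.2 i) z.1 ∂P
    -- The parameter `2 a / B` is optimal: it equates the Hoeffding term with the confidence term `2
    -- a²`.
    have key : ∀ x : ℝ, 2 * radius K δ n / lossBound L ρ * x ≤
        (2 * radius K δ n / lossBound L ρ) ^ 2 * (lossBound L ρ ^ 2 / 2) + 2 * radius K δ n ^ 2 →
        x ≤ 2 * lossBound L ρ * alpha pair δ i i T := by
      intro x hx
      have : x ≤ 2 * lossBound L ρ * radius K δ n := by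
        refine le_of_mul_le_mul_left (hx.trans (le_of_eq ?_))
          (by positivity : 0 < 2 * radius K δ n / lossBound L ρ)
        field_simp
        ring
      exact this.trans (by gcongr)
    refine abs_sub_le_iff.2 ⟨key _ ?_, key _ ?_⟩
    · rw [mul_sub]; linarith
    · rw [mul_sub]; linarith

theorem IsTraining.measure_not_concentrated_le [IsProbabilityMeasure μ]
    (h : IsTraining μ P 𝓕 Z pair)
    (hK : 1 ≤ K) (hδ : 0 < δ) (hδ' : δ < 1)
    (hl : Measurable (Function.uncurry loss)) (hL : 0 < L) (hρ : 0 < ρ)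
    (hc : LipschitzStronglyConvex X loss L ρ)
    (hbd : ∀ y, ∀ x ∈ X, |loss x y| ≤ lossBound L ρ) (hPX : ∀ᵐ z ∂P, ∀ i, z.2 i ∈ X) (T : ℕ) :
    μ {ω | ¬ Concentrated loss L ρ δ P (fun t => pair t ω) (fun t => Z t ω) T} ≤
      ENNReal.ofReal (3 * δ) := by
  have : IsProbabilityMeasure P := by
    rw [← h.data_law 0]
    exact Measure.isProbabilityMeasure_map
      ((h.data_measurable 0).mono (𝓕.le _) le_rfl).aemeasurable
  have hB : 0 < lossBound L ρ := by rw [lossBound]; positivity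
  have hb : 0 < sqDiamBound L ρ := by rw [sqDiamBound]; positivity
  have hb' : ∀ i, ∀ᵐ z ∂P, |loss (z.2 i) z.1| ≤ lossBound L ρ := fun i => by
    filter_upwards [hPX] with z hz using hbd _ _ (hz i)
  have m1 := h.measure_deviates_le hK hδ hδ' T
    (fun n i j => measurable_expTest
      ((measurable_loss_expert hl j).sub (measurable_loss_expert hl i))
      (radius K δ n / lossScale P L ρ δ n i j) (L ^ 2 * meanSqDist P i j))
    (fun n i j hn => lintegral_exp_expTest_lossDiff hl hL hρ hc hPX i j
      (radius_pos hK hδ hδ' hn))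
  have m2 := h.measure_deviates_le hK hδ hδ' T
    (fun _ i j => measurable_expTest (measurable_normSq_sub i j)
      (-(1 / (2 * sqDiamBound L ρ))) (sqDiamBound L ρ * meanSqDist P i j))
    (fun _ i j _ => lintegral_exp_expTest_normSq hL hρ hc hPX i j (by
      rw [abs_neg, abs_of_pos (by positivity), ← div_div, div_mul_cancel₀ _ hb.ne']; norm_num))
  have m3 := h.measure_deviates_le hK hδ hδ' T
    (fun _ i j => measurable_expTest (measurable_normSq_sub i j)
      (1 / sqDiamBound L ρ) (sqDiamBound L ρ * meanSqDist P i j))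
    (fun _ i j _ => lintegral_exp_expTest_normSq hL hρ hc hPX i j (by
      rw [abs_of_pos (by positivity), div_mul_cancel₀ _ hb.ne']))
  have m4 := h.measure_deviates_le hK hδ hδ' T
    (fun n i _ => measurable_expTest (measurable_loss_expert hl i)
      (2 * radius K δ n / lossBound L ρ) (lossBound L ρ ^ 2 / 2))
    (fun n i _ _ => by
      simpa only [expTest, ← mul_div_assoc] using
        lintegral_exp_le_one_of_abs_le' (measurable_loss_expert hl i) (hb' i) _)
  have m5 := h.measure_deviates_le hK hδ hδ' T
    (fun n i _ => measurable_expTest (measurable_loss_expert hl i)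
      (-(2 * radius K δ n / lossBound L ρ)) (lossBound L ρ ^ 2 / 2))
    (fun n i _ _ => by
      simpa only [expTest, ← mul_div_assoc] using
        lintegral_exp_le_one_of_abs_le' (measurable_loss_expert hl i) (hb' i) _)
  -- Five families of tests, each failing with probability at most `δ / 2`, give `5δ / 2 ≤ 3δ`.
  refine (measure_mono fun ω hω => ?_).trans ((measure_union_le _ _).trans (add_le_add
    ((measure_union_le _ _).trans (add_le_add ((measure_union_le _ _).trans (add_le_add
      ((measure_union_le _ _).trans (add_le_add m1 m2)) m3)) m4)) m5)) |>.trans ?_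
  · by_contra hcon
    simp only [Set.mem_union, not_or] at hcon
    obtain ⟨⟨⟨⟨n1, n2⟩, n3⟩, n4⟩, n5⟩ := hcon
    exact hω (concentrated_of_not_deviates hK hδ hδ' hl hL hρ hbd hPX n1 n2 n3 n4 n5)
  · rw [← ENNReal.ofReal_add, ← ENNReal.ofReal_add, ← ENNReal.ofReal_add, ← ENNReal.ofReal_add]
    · exact ENNReal.ofReal_le_ofReal (by linarith)
    all_goals positivity

end Event

/-! ### The risk of the output on the event of concentration -/

section Symmetry

variable {𝓨 : Type*} {K d : ℕ} {loss : EuclideanSpace ℝ (Fin d) → 𝓨 → ℝ} {δ : ℝ}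
  {pair : ℕ → Fin K × Fin K} {z : ℕ → Round 𝓨 K d}

theorem empDist_comm (i j : Fin K) (t : ℕ) : empDist pair z i j t = empDist pair z j i t := by
  simp only [empDist, jointRounds_comm pair i j, jointCount_comm pair i j, norm_sub_rev]

theorem alpha_comm (i j : Fin K) (t : ℕ) : alpha pair δ i j t = alpha pair δ j i t := by
  simp only [alpha, jointCount_comm pair i j]

theorem jointEmpLoss_comm (i j k : Fin K) (t : ℕ) :
    jointEmpLoss loss pair z i j k t = jointEmpLoss loss pair z j i k t := by
  simp only [jointEmpLoss, jointRounds_comm pair i j, jointCount_comm pair i j]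

end Symmetry

section Output

variable {𝓨 : Type*} [MeasurableSpace 𝓨] {K d : ℕ} {P : Measure (Round 𝓨 K d)}
  {X : Set (EuclideanSpace ℝ (Fin d))}
  {loss : EuclideanSpace ℝ (Fin d) → 𝓨 → ℝ} {L ρ δ : ℝ}
  {pair : ℕ → Fin K × Fin K} {z : ℕ → Round 𝓨 K d} {T : ℕ}

/-- The correction in the test dominates the deviation of the empirical excess, so a rejection
certifies a strictly larger true risk, which is impossible for a risk minimizer. -/
theorem Concentrated.mem_survivors (h : Concentrated loss L ρ δ P pair z T) {i : Fin K}
    (hi : ∀ j, risk loss P (fun f => f i) ≤ risk loss P (fun f => f j)) :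
    ∀ t ≤ T, i ∈ survivors loss L ρ δ pair z t := by
  classical
  intro t ht
  induction t with
  | zero => exact Finset.mem_univ i
  | succ t ih =>
    refine Finset.mem_filter.2 ⟨ih (by omega), fun u hu => ?_⟩
    have h1 := h.excess u i (t + 1) ht hu.1
    have h2 := hu.2
    have h3 := hi u
    rw [testStat] at h2
    linarith

/-- Survival of `v` bounds its empirical excess over `u` by six maxima, and the deviation bound with
the roles of `u` and `v` exchanged costs six more. -/
theorem Concentrated.risk_sub_le (h : Concentrated loss L ρ δ P pair z T) (hT : 0 < T)
    {u v : Fin K} (hv : v ∈ survivors loss L ρ δ pair z T) (hn : 0 < jointCount pair u v T) :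
    risk loss P (fun f => f v) - risk loss P (fun f => f u) ≤
      12 * max (L * alpha pair δ u v T * empDist pair z u v T)
        (lossBound L ρ * alpha pair δ u v T ^ 2) := by
  classical
  obtain ⟨t, rfl⟩ : ∃ t, T = t + 1 := ⟨T - 1, by omega⟩
  have hr := (Finset.mem_filter.1 hv).2 u
  have h1 : testStat loss L ρ δ pair z u v (t + 1) ≤ 0 := by
    by_contra! hlt; exact hr ⟨hn, hlt⟩
  have h2 := h.excess v u (t + 1) le_rfl (by rwa [jointCount_comm])
  rw [jointEmpLoss_comm v u, jointEmpLoss_comm v u, alpha_comm v u, empDist_comm v u] at h2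
  rw [testStat] at h1
  linarith

theorem risk_midpoint_le [IsProbabilityMeasure P]
    (hl : Measurable (Function.uncurry loss)) (hL : 0 ≤ L) (hρ : 0 < ρ)
    (hX : Convex ℝ X) (hc : LipschitzStronglyConvex X loss L ρ)
    (hbd : ∀ y, ∀ x ∈ X, |loss x y| ≤ lossBound L ρ) (hPX : ∀ᵐ z ∂P, ∀ i, z.2 i ∈ X)
    (k l : Fin K) :
    risk loss P (fun f => (1 / 2 : ℝ) • (f k + f l)) ≤
      (risk loss P (fun f => f k) + risk loss P (fun f => f l)) / 2
        - ρ ^ 2 / 8 * meanSqDist P k l := by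
  have hIk := integrable_loss hl hbd hPX k
  have hIl := integrable_loss hl hbd hPX l
  have hId := integrable_normSq_sub hL hρ hc hPX k l
  have hmid : Integrable (fun z : Round 𝓨 K d => loss ((1 / 2 : ℝ) • (z.2 k + z.2 l)) z.1) P := by
    refine .of_bound (C := lossBound L ρ) (hl.comp (f := fun z : Round 𝓨 K d =>
      ((1 / 2 : ℝ) • (z.2 k + z.2 l), z.1)) (by fun_prop)).aestronglyMeasurable ?_
    filter_upwards [hPX] with z hz
    refine hbd _ _ ?_
    rw [smul_add]
    exact hX (hz k) (hz l) (by norm_num) (by norm_num) (by norm_num)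
  have hsum : Integrable (fun z : Round 𝓨 K d => (loss (z.2 k) z.1 + loss (z.2 l) z.1) / 2) P :=
    (hIk.add hIl).div_const 2
  calc risk loss P (fun f => (1 / 2 : ℝ) • (f k + f l))
      ≤ ∫ z, ((loss (z.2 k) z.1 + loss (z.2 l) z.1) / 2
          - ρ ^ 2 / 8 * ‖z.2 k - z.2 l‖ ^ 2) ∂P := by
        refine integral_mono_ae hmid (hsum.sub (hId.const_mul _)) ?_
        filter_upwards [hPX] with z hz using hc.midpoint_le z.1 (hz k) (hz l)
    _ = _ := by
        rw [integral_sub hsum (hId.const_mul _), integral_div, integral_add hIk hIl,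
          integral_const_mul]
        rfl

/-- The gain from strong convexity absorbs an excess risk proportional to the distance. -/
theorem excess_absorbed {A D d2 B b : ℝ} (hρ : 0 < ρ) (hLB : L ^ 2 / ρ ^ 2 = B / 8)
    (hb : ρ ^ 2 * b = 2 * B) (hB : 0 ≤ B) (hd : D ^ 2 ≤ 2 * d2 + 2 * b * A ^ 2)
    (hL : 0 ≤ L) (hA : 0 ≤ A) (hD : 0 ≤ D) :
    18 * max (L * A * D) (B * A ^ 2) - ρ ^ 2 / 8 * d2 ≤ 181 * B * A ^ 2 := by
  have h1 : max (L * A * D) (B * A ^ 2) ≤ L * A * D + B * A ^ 2 :=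
    max_le_add_of_nonneg (by positivity) (by positivity)
  -- The weight `ρ² / 16` is dictated by `D² ≤ 2 d2 + …`: it turns into exactly the available gain
  -- `ρ² / 8 * d2`. The final constant is `18 + 1296 / 8 + 1 / 4`, rounded up to `181`.
  have h2 : 18 * (L * A * D) ≤ ρ ^ 2 / 16 * D ^ 2 + 1296 * (L ^ 2 / ρ ^ 2) * A ^ 2 := by
    have h := sq_nonneg (ρ / 4 * D - 36 * (L / ρ) * A)
    have e : (ρ / 4 * D - 36 * (L / ρ) * A) ^ 2 =
        ρ ^ 2 / 16 * D ^ 2 + 1296 * (L ^ 2 / ρ ^ 2) * A ^ 2 - 18 * (L * A * D) := by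
      field_simp
      ring
    linarith
  rw [hLB] at h2
  have h3 := mul_le_mul_of_nonneg_left hd (by positivity : 0 ≤ ρ ^ 2 / 16)
  have h4 : ρ ^ 2 / 16 * (2 * d2 + 2 * b * A ^ 2) = ρ ^ 2 / 8 * d2 + B * A ^ 2 / 4 := by
    linear_combination A ^ 2 / 8 * hb
  have h5 : 0 ≤ B * A ^ 2 := by positivity
  linarith

/-- The risk of the mean of two distinct surviving experts. -/
theorem Concentrated.risk_midpoint_sub_le [IsProbabilityMeasure P]
    (h : Concentrated loss L ρ δ P pair z T) (hrun : IsQueryingRun loss L ρ δ pair z)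
    (hK : 1 ≤ K) (hδ : 0 < δ) (hδ' : δ < 1) (hT : 0 < T)
    (hl : Measurable (Function.uncurry loss)) (hL : 0 < L) (hρ : 0 < ρ)
    (hX : Convex ℝ X) (hc : LipschitzStronglyConvex X loss L ρ)
    (hbd : ∀ y, ∀ x ∈ X, |loss x y| ≤ lossBound L ρ) (hPX : ∀ᵐ z ∂P, ∀ i, z.2 i ∈ X)
    (hpos : ∀ u ∈ survivors loss L ρ δ pair z T, ∀ v ∈ survivors loss L ρ δ pair z T,
      0 < jointCount pair u v T)
    {i k l : Fin K} (hi : i ∈ survivors loss L ρ δ pair z T)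
    (hk : k ∈ survivors loss L ρ δ pair z T) (hl' : l ∈ survivors loss L ρ δ pair z T)
    (hkl : k ≠ l) (hmax : empDist pair z k i T ≤ empDist pair z k l T) :
    risk loss P (fun f => (1 / 2 : ℝ) • (f k + f l)) ≤ risk loss P (fun f => f i) +
      362 * lossBound L ρ * (logConf K δ T / jointCount pair k l T) := by
  have hB : 0 < lossBound L ρ := by rw [lossBound]; positivity
  have hb : 0 < sqDiamBound L ρ := by rw [sqDiamBound]; positivity
  have hlog := logConf_pos hK hδ hδ' hT
  have hN : (0 : ℝ) < jointCount pair k l T := by exact_mod_cast hpos k hk l hl'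
  -- The factor two makes `A` a common bound for `α_uv` over all pairs of survivors, since `T_kl ≤
  -- T_uv + 1 ≤ 2 T_uv`.
  set A := √(2 * (logConf K δ T / jointCount pair k l T)) with hA
  have hA2 : A ^ 2 = 2 * (logConf K δ T / jointCount pair k l T) := Real.sq_sqrt (by positivity)
  have hA0 : 0 ≤ A := Real.sqrt_nonneg _
  set D := empDist pair z k l T
  have hD : 0 ≤ D := Real.sqrt_nonneg _
  have hα : ∀ u v, u ∈ survivors loss L ρ δ pair z T → v ∈ survivors loss L ρ δ pair z T →
      0 ≤ alpha pair δ u v T ∧ alpha pair δ u v T ≤ A := by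
    intro u v hu hv
    refine ⟨Real.sqrt_nonneg _, Real.sqrt_le_sqrt ?_⟩
    change logConf K δ T / _ ≤ _
    have h1 : (jointCount pair k l T : ℝ) ≤ jointCount pair u v T + 1 := by
      exact_mod_cast hrun.jointCount_le_add_one hu hv hkl
    have h2 : (1 : ℝ) ≤ jointCount pair u v T := by exact_mod_cast hpos u hu v hv
    rw [← mul_div_assoc, div_le_div_iff₀ (by linarith) hN]
    nlinarith
  have hbnd : ∀ u v, u ∈ survivors loss L ρ δ pair z T → v ∈ survivors loss L ρ δ pair z T →
      empDist pair z u v T ≤ D →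
      risk loss P (fun f => f v) - risk loss P (fun f => f u) ≤
        12 * max (L * A * D) (lossBound L ρ * A ^ 2) := by
    intro u v hu hv hd
    obtain ⟨h0, h1⟩ := hα u v hu hv
    refine (h.risk_sub_le hT hv (hpos u hu v hv)).trans ?_
    have : 0 ≤ empDist pair z u v T := Real.sqrt_nonneg _
    gcongr
  -- The average excess of `k` and `l` over `i` is `(R_k - R_i) + (R_l - R_k) / 2`. The two bounds
  -- by twelve maxima thus give the coefficient `18 = 12 + 6` in `excess_absorbed`.
  have e1 := hbnd i k hi hk (by rw [empDist_comm]; exact hmax)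
  have e2 := hbnd k l hk hl' le_rfl
  have e3 := risk_midpoint_le hl hL.le hρ hX hc hbd hPX k l
  have e4 : D ^ 2 ≤ 2 * meanSqDist P k l + 2 * sqDiamBound L ρ * A ^ 2 := by
    refine (h.dist k l (hpos k hk l hl')).trans ?_
    obtain ⟨h0, h1⟩ := hα k l hk hl'
    gcongr
  have e5 := excess_absorbed (L := L) hρ (by rw [lossBound]; ring) (sq_mul_sqDiamBound hρ)
    hB.le e4 hL.le hA0 hD
  have e6 : 362 * lossBound L ρ * (logConf K δ T / jointCount pair k l T) =
      181 * lossBound L ρ * A ^ 2 := by rw [hA2]; ring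
  rw [e6]
  linarith

/-- The risk of the empirical risk minimizer among the surviving experts. -/
theorem Concentrated.risk_erm_sub_le
    (h : Concentrated loss L ρ δ P pair z T) (hrun : IsQueryingRun loss L ρ δ pair z)
    (hK : 1 ≤ K) (hδ : 0 < δ) (hδ' : δ < 1) (hT : 0 < T) (hB : 0 ≤ lossBound L ρ)
    {i q : Fin K} (hi : i ∈ survivors loss L ρ δ pair z T)
    (hqpos : 0 < queryCount pair q T) (hKi : K ≤ 2 * queryCount pair i T)
    (hq : empLoss loss pair z q T ≤ empLoss loss pair z i T) :
    risk loss P (fun f => f q) ≤ risk loss P (fun f => f i) +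
      8 * lossBound L ρ * √(logConf K δ T / queryCount pair q T) := by
  have hlog := logConf_pos hK hδ hδ' hT
  have hipos : 0 < queryCount pair i T := by omega
  have hqc := hrun.queryCount_le hi q
  have h1 := (abs_le.1 (h.emp q hqpos)).1
  have h2 := (abs_le.1 (h.emp i hipos)).2
  have a1 : alpha pair δ q q T = √(logConf K δ T / queryCount pair q T) := by
    rw [queryCount_eq_jointCount]; rfl
  -- From `T_q ≤ 2K + 4 T_i` and `K ≤ 2 T_i`, one has `T_q ≤ 8 T_i`, relaxed to `9` to obtain an
  -- integer square root.
  have a2 : alpha pair δ i i T ≤ 3 * √(logConf K δ T / queryCount pair q T) := by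
    have e : alpha pair δ i i T = √(logConf K δ T / queryCount pair i T) := by
      rw [queryCount_eq_jointCount]; rfl
    have h9 : (3 : ℝ) = √9 := by
      rw [show (9 : ℝ) = 3 ^ 2 by norm_num, Real.sqrt_sq (by norm_num)]
    rw [e, h9, ← Real.sqrt_mul (by norm_num)]
    refine Real.sqrt_le_sqrt ?_
    have hi' : (0 : ℝ) < queryCount pair i T := by exact_mod_cast hipos
    have hq' : (0 : ℝ) < queryCount pair q T := by exact_mod_cast hqpos
    have h8 : (queryCount pair q T : ℝ) ≤ 9 * queryCount pair i T := by
      exact_mod_cast (by omega : queryCount pair q T ≤ 9 * queryCount pair i T)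
    rw [← mul_div_assoc, div_le_div_iff₀ hi' hq']
    nlinarith
  have h3 := mul_le_mul_of_nonneg_left a2 (by linarith : 0 ≤ 2 * lossBound L ρ)
  rw [a1] at h1
  linarith

theorem logConf_le (hK : 1 ≤ K) (hδ : 0 < δ) (hδ' : δ < 1) (hT : 2 ≤ T) :
    logConf K δ T ≤ 5 * Real.log (T * K * δ⁻¹) := by
  have hK' : (1 : ℝ) ≤ K := by exact_mod_cast hK
  have hT' : (2 : ℝ) ≤ T := by exact_mod_cast hT
  have hd : 1 ≤ δ⁻¹ := (one_le_inv₀ hδ).2 hδ'.le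
  rw [logConf, ← Real.log_rpow (by positivity)]
  refine Real.log_le_log (by positivity) ?_
  rw [inv_div, div_eq_mul_inv, show (5 : ℝ) = (5 : ℕ) by norm_num, Real.rpow_natCast]
  -- The exponent is set by the smallest case `T = 2`, where `24 ≤ 2 ^ 5` but `24 > 2 ^ 4`.
  have h1 : (T : ℝ) * (T + 1) * 4 ≤ T ^ 5 := by
    nlinarith [pow_le_pow_left₀ (by norm_num) hT' 3, pow_pos (by linarith : (0 : ℝ) < T) 2]
  calc 4 * K * (T * (T + 1) * δ⁻¹) = (T * (T + 1) * 4) * K * δ⁻¹ := by ring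
    _ ≤ T ^ 5 * K ^ 5 * δ⁻¹ ^ 5 := by
        gcongr
        · exact le_self_pow₀ hK' (by norm_num)
        · exact le_self_pow₀ hd (by norm_num)
    _ = _ := by ring

/-- Both rates are dominated by the two quantities which the stopping rule compares. -/
theorem rate_bounds {k T N Q ℓ : ℝ} (hT : 0 < T) (hℓ : 0 < ℓ) (hQ : 0 < Q)
    (hN : 0 < N) (hTN : T ≤ 2 * k ^ 2 * N) (hTQ : T ≤ 4 * k * Q) :
    ℓ / N ≤ 2 * (k ^ 2 * ℓ / T) ∧ √(ℓ / Q) ≤ 2 * √(k * ℓ / T) ∧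
    (√(ℓ * Q) < N → ℓ / N ≤ √(ℓ / Q)) ∧ (N ≤ √(ℓ * Q) → √(ℓ / Q) ≤ ℓ / N) := by
  have hs : √(ℓ / Q) = ℓ / √(ℓ * Q) := by
    rw [eq_div_iff (by positivity), ← Real.sqrt_mul (by positivity),
      show ℓ / Q * (ℓ * Q) = ℓ ^ 2 by field_simp, Real.sqrt_sq hℓ.le]
  refine ⟨?_, ?_, ?_, ?_⟩
  · rw [← mul_div_assoc, div_le_div_iff₀ hN hT]; nlinarith
  · rw [show (2 : ℝ) = √(2 ^ 2) by rw [Real.sqrt_sq (by norm_num)],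
      ← Real.sqrt_mul (by positivity)]
    refine Real.sqrt_le_sqrt ?_
    rw [← mul_div_assoc, div_le_div_iff₀ hQ hT]; nlinarith
  · intro h; rw [hs]; gcongr
  · intro h; rw [hs]; gcongr

theorem Concentrated.risk_output_le [IsProbabilityMeasure P]
    (h : Concentrated loss L ρ δ P pair z T) (hrun : IsQueryingRun loss L ρ δ pair z)
    (hK : 1 ≤ K) (hδ : 0 < δ) (hδ' : δ < 1) (hT : 2 * K ^ 2 ≤ T)
    (hl : Measurable (Function.uncurry loss)) (hL : 0 < L) (hρ : 0 < ρ)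
    (hX : Convex ℝ X) (hc : LipschitzStronglyConvex X loss L ρ)
    (hbd : ∀ y, ∀ x ∈ X, |loss x y| ≤ lossBound L ρ) (hPX : ∀ᵐ z ∂P, ∀ i, z.2 i ∈ X)
    {k l q : Fin K} (hsel : IsSelection loss L ρ δ pair z T k l q) :
    risk loss P (output δ pair T k l q) ≤ bestRisk loss P + 4000 * lossBound L ρ *
      min ((K : ℝ) ^ 2 * Real.log (T * K * δ⁻¹) / T) (√(K * Real.log (T * K * δ⁻¹) / T)) := by
  have hB : 0 < lossBound L ρ := by rw [lossBound]; positivity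
  have : Nonempty (Fin K) := ⟨⟨0, hK⟩⟩
  obtain ⟨i, hi⟩ := exists_eq_ciInf_of_finite (f := fun i : Fin K => risk loss P (fun f => f i))
  change risk loss P (fun f => f i) = bestRisk loss P at hi
  have hmin : ∀ j, risk loss P (fun f => f i) ≤ risk loss P (fun f => f j) := fun j =>
    hi.trans_le (ciInf_le (Set.finite_range _).bddBelow j)
  have hiS := h.mem_survivors hmin T le_rfl
  -- The surviving best expert makes `S` nonempty, so the case where the selection is unconstrained
  -- does not arise.
  obtain ⟨hk, hl', hmax, hlk, hq, hqmin⟩ := hsel ⟨i, hiS⟩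
  have hK2 : 1 ≤ K ^ 2 := Nat.one_le_pow _ _ hK
  have hT2 : 2 ≤ T := by omega
  have hpair : ∀ u ∈ survivors loss L ρ δ pair z T, ∀ v ∈ survivors loss L ρ δ pair z T,
      T ≤ 2 * K ^ 2 * jointCount pair u v T := by
    intro u hu v hv
    have := hrun.le_sq_mul_jointCount hu hv
    nlinarith
  have hpos : ∀ u ∈ survivors loss L ρ δ pair z T, ∀ v ∈ survivors loss L ρ δ pair z T,
      0 < jointCount pair u v T := by
    intro u hu v hv
    refine Nat.pos_of_ne_zero fun h0 => ?_
    have := hpair u hu v hv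
    rw [h0] at this
    omega
  have hquery : ∀ u ∈ survivors loss L ρ δ pair z T, T ≤ 4 * K * queryCount pair u T := by
    intro u hu
    have := hrun.le_mul_queryCount hu
    nlinarith
  have hqpos : 0 < queryCount pair q T := by
    rw [queryCount_eq_jointCount]; exact hpos q hq q hq
  have hKi : K ≤ 2 * queryCount pair i T := by
    have h1 := hquery i hiS
    have h2 : K * (2 * K) ≤ K * (4 * queryCount pair i T) := by nlinarith
    have := Nat.le_of_mul_le_mul_left h2 hK
    omega
  have hK' : (0 : ℝ) < K := by exact_mod_cast hK
  have hT' : (2 : ℝ) ≤ T := by exact_mod_cast hT2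
  set ℓ := Real.log (T * K * δ⁻¹) with hℓ
  have hlog := logConf_le hK hδ hδ' hT2
  rw [← hℓ] at hlog
  have hℓ0 : 0 < ℓ := by
    have := logConf_pos hK hδ hδ' (by omega : 0 < T)
    linarith
  have hN : (0 : ℝ) < jointCount pair k l T := by exact_mod_cast hpos k hk l hl'
  have hQ : (0 : ℝ) < queryCount pair q T := by exact_mod_cast hqpos
  obtain ⟨r1, r2, r3, r4⟩ := rate_bounds (k := K) (T := T) (by linarith) hℓ0 hQ hN
    (by exact_mod_cast hpair k hk l hl') (by exact_mod_cast hquery q hq)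
  set rate := min ((K : ℝ) ^ 2 * ℓ / T) (√(K * ℓ / T)) with hrate
  have hrate0 : 0 ≤ rate := le_min (by positivity) (by positivity)
  rw [← hi]
  have hcond : Real.log (K * T * δ⁻¹) = ℓ := by rw [hℓ, mul_comm (K : ℝ)]
  by_cases hcase : √(ℓ * queryCount pair q T) < jointCount pair k l T
  · have hout : output δ pair T k l q = fun f : Fin K → EuclideanSpace ℝ (Fin d) =>
        (1 / 2 : ℝ) • (f k + f l) := by
      funext f
      rw [output, hcond, if_pos hcase]
    rw [hout]
    by_cases hkl : k = l
    -- Coinciding experts mean `S = {k}`; the best expert survives, so it is `k`, and the midpoint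
    -- has no excess risk.
    · subst hkl
      have hik : i = k := by
        have := hlk rfl ▸ hiS
        simpa using this
      have : (fun f : Fin K → EuclideanSpace ℝ (Fin d) => (1 / 2 : ℝ) • (f k + f k)) =
          fun f => f k := by
        funext f; module
      rw [this, hik]
      exact le_add_of_nonneg_right (by positivity)
    · refine (h.risk_midpoint_sub_le hrun hK hδ hδ' (by omega) hl hL hρ hX hc hbd hPX hpos hiS hk
        hl' hkl (hmax i hiS)).trans ?_
      have hle : ℓ / jointCount pair k l T ≤ 2 * rate := by
        rw [hrate, mul_min_of_nonneg _ _ zero_le_two]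
        exact le_min r1 ((r3 hcase).trans r2)
      have : logConf K δ T / jointCount pair k l T ≤ 10 * rate := by
        calc logConf K δ T / jointCount pair k l T ≤ 5 * ℓ / jointCount pair k l T := by gcongr
          _ = 5 * (ℓ / jointCount pair k l T) := mul_div_assoc _ _ _
          _ ≤ 10 * rate := by linarith
      have h1 := mul_le_mul_of_nonneg_left this (by positivity : 0 ≤ 362 * lossBound L ρ)
      have h2 : 0 ≤ lossBound L ρ * rate := by positivity
      linarith
  · have hout : output δ pair T k l q = fun f : Fin K → EuclideanSpace ℝ (Fin d) => f q := by
      funext f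
      rw [output, hcond, if_neg hcase]
    rw [hout]
    refine (h.risk_erm_sub_le hrun hK hδ hδ' (by omega) hB.le hiS hqpos hKi
      (hqmin i hiS)).trans ?_
    have hle : √(ℓ / queryCount pair q T) ≤ 2 * rate := by
      rw [hrate, mul_min_of_nonneg _ _ zero_le_two]
      exact le_min ((r4 (not_lt.1 hcase)).trans r1) r2
    have : √(logConf K δ T / queryCount pair q T) ≤ 6 * rate := by
      calc √(logConf K δ T / queryCount pair q T) ≤ √(3 ^ 2 * (ℓ / queryCount pair q T)) := by
            refine Real.sqrt_le_sqrt ?_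
            rw [← mul_div_assoc]
            gcongr
            linarith
        _ = 3 * √(ℓ / queryCount pair q T) := by
            rw [Real.sqrt_mul (by positivity), Real.sqrt_sq (by norm_num)]
        _ ≤ 6 * rate := by linarith
    have h1 := mul_le_mul_of_nonneg_left this (by positivity : 0 ≤ 8 * lossBound L ρ)
    have h2 : 0 ≤ lossBound L ρ * rate := by positivity
    linarith

theorem output_mem (hX : Convex ℝ X) (k l q : Fin K) {f : Fin K → EuclideanSpace ℝ (Fin d)}
    (hf : ∀ i, f i ∈ X) : output δ pair T k l q f ∈ X := by
  rw [output]
  split_ifs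
  · rw [smul_add]
    exact hX (hf k) (hf l) (by norm_num) (by norm_num) (by norm_num)
  · exact hf q

theorem risk_eq_zero_of_lossBound_eq_zero (hbd : ∀ y, ∀ x ∈ X, |loss x y| ≤ lossBound L ρ)
    (hB : lossBound L ρ = 0) {g : (Fin K → EuclideanSpace ℝ (Fin d)) → EuclideanSpace ℝ (Fin d)}
    (hg : ∀ᵐ z ∂P, g z.2 ∈ X) : risk loss P g = 0 := by
  refine integral_eq_zero_of_ae ?_
  filter_upwards [hg] with z hz
  exact abs_nonpos_iff.1 ((hbd z.1 _ hz).trans_eq hB)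

end Output

end ExpertAdvice

/-! ### Conclusion, with the degenerate case of zero Lipschitz constant. -/

open ExpertAdvice in
theorem mainTheorem1 :
    ∃ c : ℝ, 0 < c ∧
      ∀ (Ω : Type*) (mΩ : MeasurableSpace Ω) (μ : Measure Ω) (_ : IsProbabilityMeasure μ)
        (𝓨 : Type*) (_ : MeasurableSpace 𝓨) (d K : ℕ) (_ : 1 ≤ K)
        (X : Set (EuclideanSpace ℝ (Fin d))) (_ : IsClosed X) (_ : Convex ℝ X)
        (loss : EuclideanSpace ℝ (Fin d) → 𝓨 → ℝ) (_ : Measurable (Function.uncurry loss))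
        (L ρ : ℝ) (_ : 0 ≤ L) (_ : 0 < ρ)
        (_ : ExpertAdvice.LipschitzStronglyConvex X loss L ρ)
        (_ : ∀ y, ∀ x ∈ X, |loss x y| ≤ ExpertAdvice.lossBound L ρ)
        (P : Measure (ExpertAdvice.Round 𝓨 K d)) (_ : ∀ᵐ z ∂P, ∀ i, z.2 i ∈ X)
        (δ : ℝ) (_ : 0 < δ) (_ : δ < 1)
        (𝓕 : Filtration ℕ mΩ) (Z : ℕ → Ω → ExpertAdvice.Round 𝓨 K d)
        (pair : ℕ → Ω → Fin K × Fin K) (_ : ExpertAdvice.IsTraining μ P 𝓕 Z pair)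
        (_ : ∀ ω, ExpertAdvice.IsQueryingRun loss L ρ δ (fun t => pair t ω) (fun t => Z t ω))
        (T : ℕ) (_ : 2 * K ^ 2 ≤ T) (k l q : Ω → Fin K)
        (_ : ∀ ω, ExpertAdvice.IsSelection loss L ρ δ (fun t => pair t ω) (fun t => Z t ω) T
          (k ω) (l ω) (q ω)),
        ENNReal.ofReal (1 - 3 * δ) ≤
          μ {ω | ExpertAdvice.risk loss P
                (ExpertAdvice.output δ (fun t => pair t ω) T (k ω) (l ω) (q ω)) ≤
              ExpertAdvice.bestRisk loss P +
                c * ExpertAdvice.lossBound L ρ *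
                  min ((K : ℝ) ^ 2 * Real.log (T * K * δ⁻¹) / T)
                    (Real.sqrt (K * Real.log (T * K * δ⁻¹) / T))} := by
  refine ⟨4000, by norm_num, ?_⟩
  intro Ω mΩ μ _ 𝓨 _ d K hK X _ hX loss hl L ρ hL hρ hc hbd P hPX δ hδ hδ' 𝓕 Z pair htr hrun T hT
    k l q hsel
  have : IsProbabilityMeasure P := by
    rw [← htr.data_law 0]
    exact Measure.isProbabilityMeasure_map
      ((htr.data_measurable 0).mono (𝓕.le _) le_rfl).aemeasurable
  -- For `L = 0` the Chernoff parameters would divide by `B = 0`. In that case the loss vanishes on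
  -- `X`, so all the risks involved are zero.
  rcases hL.eq_or_lt with rfl | hL
  · have hB : lossBound 0 ρ = 0 := by simp [lossBound]
    have h1 : ∀ ω, risk loss P (output δ (fun t => pair t ω) T (k ω) (l ω) (q ω)) = 0 := fun ω =>
      risk_eq_zero_of_lossBound_eq_zero hbd hB (by
        filter_upwards [hPX] with z hz using output_mem hX _ _ _ hz)
    have h2 : bestRisk loss P = 0 := by
      have h3 : ∀ i : Fin K, risk loss P (fun f => f i) = 0 := fun i =>
        risk_eq_zero_of_lossBound_eq_zero hbd hB (by
          filter_upwards [hPX] with z hz using hz i)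
      simp [bestRisk, h3]
    simp only [h1, h2, hB, mul_zero, zero_mul, add_zero, le_refl, Set.ofPred_true, measure_univ]
    exact ENNReal.ofReal_le_one.2 (by linarith)
  · have hbad := htr.measure_not_concentrated_le hK hδ hδ' hl hL hρ hc hbd hPX T
    rw [ENNReal.ofReal_sub _ (by positivity), ENNReal.ofReal_one, tsub_le_iff_right]
    -- The selections `k`, `l`, `q` are arbitrary functions of `ω`, so the events need not be
    -- measurable. Covering the whole space by the good and bad events and using subadditivity
    -- avoids taking complements.
    rw [← measure_univ (μ := μ)]
    refine (measure_mono fun ω _ => ?_).trans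
      ((measure_union_le _ _).trans (add_le_add le_rfl hbad))
    by_cases hω : Concentrated loss L ρ δ P (fun t => pair t ω) (fun t => Z t ω) T
    · exact Or.inl (hω.risk_output_le (hrun ω) hK hδ hδ' hT hl hL hρ hX hc hbd hPX (hsel ω))
    · exact Or.inr hω
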